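/- **Setting.** A Markov chain $(\mathcal X,K,\pi)$ consists of a countable set $\mathcal X$, an irreducible stochastic matrix $K$ indexed by $\mathcal X$ and a stationary probability $\pi$ of $K$. Put $H_t=e^{-t(I-K)}=e^{-t}\sum_{m\ge 0}\frac{t^m}{m!}K^m$ and, for $t\ge 0$, $$d_{TV}(t)=\sup_{x\in\mathcal X,\,A\subset\mathcal X}\{H_t(x,A)-\pi(A)\},\qquad d_{H}(t)=\sup_{x\in\mathcal X}\Big(\tfrac12\sum_{y\in\mathcal X}\big(\sqrt{H_t(x,y)}-\sqrt{\pi(y)}\big)^2\Big)^{1/2},$$ and $T_*(\epsilon)=\inf\{t\ge 0: d_*(t)\le\epsilon\}$ for $*\in\{TV,H\}$. A family of continuous time chains $(\mathcal X_n,H_{n,t},\pi_n)_{n\ge1}$ with distances $d_{n,*}$ has a cutoff (in $*$) with cutoff time $t_n$ if $t_n>0$ for all $n$, $\lim_n d_{n,*}(at_n)=0$ for all $a>1$ and $\lim_n d_{n,*}(at_n)=1$ for all $a\in(0,1)$. Let $k_n$ be positive integers with $k_n\to\infty$. For $n\ge1$ and $1\le i\le k_n$ let $(\mathcal X_{n,i},K_{n,i},\pi_{n,i})$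 be a Markov chain with at least two states, with continuous time transition matrices $H_{n,i,t}$ and mixing times $T_{n,i,*}$, and let $p_{n,i}>0$. Put $q_n=p_{n,1}+\dots+p_{n,k_n}$ and let $\mathcal F^{\mathcal P}_c$ be the family of continuous time chains associated with the product chains on $\mathcal X_{n,1}\times\dots\times\mathcal X_{n,k_n}$ with transition matrix $\sum_{i=1}^{k_n}\frac{p_{n,i}}{q_n}\,I\otimes\dots\otimes I\otimes K_{n,i}\otimes I\otimes\dots\otimes I$ (with $K_{n,i}$ in the $i$-th factor) and stationary distribution $\pi_{n,1}\times\dots\times\pi_{n,k_n}$. Set $\varrho_{TV}=1$, $\varrho_H=2$, fix $*\in\{TV,H\}$ and let $\epsilon_{n,i}\in(0,1/(2\varrho_*))$ with $\inf_{n,i}\epsilon_{n,i}>0$. Write $T_{n,i}=T_{n,i,*}(\epsilon_{n,i})$ and assume that all $T_{n,i}$ are finite (which is automatic for finite state spaces). Define $$s_n=\max_{1\le i\le k_n}\frac{T_{n,i}}{p_{n,i}},\qquad R(c)=\lim_{m\to\infty}\limsup_{n\to\infty}\sum_{i=1}^{k_n-m}(2\varrho_*\epsilon_{n,i})^{c\varrho_*s_np_{n,i}/T_{n,i}}\in[0,\infty].$$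 **Theorem.** For each $*\in\{TV,H\}$, with cutoffs understood in $*$: (1) Let $t_{n,i}>0$ for $1\le i\le k_n$, $n\ge1$, and $t_n=\max_{1\le i\le k_n}t_{n,i}/p_{n,i}$. Suppose that $R(c)=0$ for all $c>1$ and that, for every $m\ge0$, the family $(\mathcal X_{n,k_n-m},H_{n,k_n-m,t},\pi_{n,k_n-m})_n$ (defined for all large $n$) has a cutoff with cutoff time $t_{n,k_n-m}$. Then $\mathcal F^{\mathcal P}_c$ has a cutoff with cutoff time $q_ns_n$, and $\limsup_n s_n/t_n\le1$. If moreover $\sup_{n,i}t_{n,i}/T_{n,i}<\infty$, then $s_n/t_n\to1$. (2) Suppose that $R(c)=0$ for some $c\in(0,1)$ and that $\mathcal F^{\mathcal P}_c$ has a cutoff with cutoff time $v_n$. Then there are positive integers $j_1<j_2<\cdots$ and $J_n$ with $1\le J_n\le k_{j_n}$ and $k_{j_n}-J_n=O(1)$ such that the family $(\mathcal X_{j_n,J_n},H_{j_n,J_n,t},\pi_{j_n,J_n})_{n\ge1}$ has a cutoff with cutoff time $p_{j_n,J_n}v_{j_n}/q_{j_n}$. -/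

import Mathlib

open Filter Topology

namespace ProductChain

noncomputable section

universe u v

/-- The identity matrix indexed by `X`. -/
def idKernel {X : Type u} (x y : X) : ℝ :=
  open Classical in if x = y then 1 else 0

/-- The powers `K ^ m` of a (possibly infinite) matrix indexed by `X`. -/
def kernelPow {X : Type u} (K : X → X → ℝ) : ℕ → X → X → ℝ
  | 0 => idKernel
  | m + 1 => fun x y => ∑' z, K x z * kernelPow K m z y

/-- `(X, K, π)` is an irreducible Markov chain: `K` is an irreducible stochastic matrix and
`π` is a probability on `X` which is stationary for `K`. -/
structure IsIrreducibleChain {X : Type u} (K : X → X → ℝ) (π : X → ℝ) : Prop where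
  nonneg : ∀ x y, 0 ≤ K x y
  hasSum_row : ∀ x, HasSum (K x) 1
  irreducible : ∀ x y, ∃ m : ℕ, 0 < kernelPow K m x y
  pi_nonneg : ∀ x, 0 ≤ π x
  hasSum_pi : HasSum π 1
  stationary : ∀ y, HasSum (fun x => π x * K x y) (π y)

/-- The transition matrix `H_t = e^{-t(I-K)} = e^{-t} ∑ₘ (t ^ m / m!) K ^ m` of the continuous time
chain associated with `K`, that is, of the chain `K` run at the jump times of an independent Poisson
process of rate one. -/
def heatKernel {X : Type u} (K : X → X → ℝ) (t : ℝ) (x y : X) : ℝ :=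
  Real.exp (-t) * ∑' m : ℕ, t ^ m / (m.factorial : ℝ) * kernelPow K m x y

/-- Total variation distance `sup_A (μ(A) - ν(A))`. -/
def tvDist {X : Type u} (μ ν : X → ℝ) : ℝ :=
  ⨆ A : Set X, ((∑' y : A, μ y) - (∑' y : A, ν y))

/-- Hellinger distance `(½ ∑_y (√μ(y) - √ν(y))²)^{1/2}`. -/
def hellingerDist {X : Type u} (μ ν : X → ℝ) : ℝ :=
  Real.sqrt ((1 / 2) * ∑' y, (Real.sqrt (μ y) - Real.sqrt (ν y)) ^ 2)

/-- The two distances under consideration: total variation and Hellinger. -/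
inductive DistKind where
  | TV : DistKind
  | H : DistKind

/-- The constant `ϱ`, equal to `1` for total variation and to `2` for Hellinger. -/
def rho : DistKind → ℝ
  | DistKind.TV => 1
  | DistKind.H => 2

/-- The distance between two probabilities on a countable set. -/
def probDist {X : Type u} : DistKind → (X → ℝ) → (X → ℝ) → ℝ
  | DistKind.TV => tvDist
  | DistKind.H => hellingerDist

/-- The maximum distance `d(t) = sup_x ‖H_t(x, ·) - π‖` of the continuous time chain. -/
def maxDist (D : DistKind) {X : Type u} (K : X → X → ℝ) (π : X → ℝ) (t : ℝ) : ℝ :=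
  ⨆ x : X, probDist D (heatKernel K t x) π

/-- The mixing time `T(ε) = inf {t ≥ 0 | d(t) ≤ ε}` of the continuous time chain. The value is
meaningful only when this set is non-empty, i.e. when the mixing time is finite. -/
def mixingTime (D : DistKind) {X : Type u} (K : X → X → ℝ) (π : X → ℝ) (ε : ℝ) : ℝ :=
  sInf {t : ℝ | 0 ≤ t ∧ maxDist D K π t ≤ ε}

/-- The mixing time at level `ε` is finite. -/
def MixingTimeFinite (D : DistKind) {X : Type u} (K : X → X → ℝ) (π : X → ℝ) (ε : ℝ) : Prop :=
  ∃ t : ℝ, 0 ≤ t ∧ maxDist D K π t ≤ ε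

/-- A family of continuous time chains with maximum distances `d n` has a cutoff with cutoff
time `t n`. -/
def HasCutoffAt (d : ℕ → ℝ → ℝ) (t : ℕ → ℝ) : Prop :=
  (∀ n, 0 < t n) ∧
  (∀ a : ℝ, 1 < a → Tendsto (fun n => d n (a * t n)) atTop (𝓝 0)) ∧
  (∀ a : ℝ, 0 < a → a < 1 → Tendsto (fun n => d n (a * t n)) atTop (𝓝 1))

/-- `∑ i, w i • (I ⊗ ⋯ ⊗ K i ⊗ ⋯ ⊗ I)`: the transition matrix of the product chain according to the
probability vector `w`. -/
def prodKernel {ι : Type v} [Fintype ι] [DecidableEq ι] {X : ι → Type u} (w : ι → ℝ)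
    (K : ∀ i, X i → X i → ℝ) (x y : ∀ i, X i) : ℝ :=
  ∑ i, w i * ∏ j, if j = i then K j (x j) (y j) else idKernel (x j) (y j)

/-- The product of the stationary distributions. -/
def prodPi {ι : Type v} [Fintype ι] {X : ι → Type u} (π : ∀ i, X i → ℝ) (x : ∀ i, X i) : ℝ :=
  ∏ i, π i (x i)

/-- The maximum distance of the continuous time chain associated with the product chain of
`(X i, K i, π i)`, `i < N`, according to the probability vector `p i / (∑ j, p j)`. -/
def prodMaxDist (D : DistKind) {N : ℕ} {X : Fin N → Type u} (p : Fin N → ℝ)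
    (K : ∀ i, X i → X i → ℝ) (π : ∀ i, X i → ℝ) (t : ℝ) : ℝ :=
  maxDist D (prodKernel (fun i => p i / ∑ j, p j) K) (prodPi π) t

/-- The `m`-th index counted from the end of `Fin N` (`m = 0` is the last one); it is the first
index if `m ≥ N`. -/
def fromEnd {N : ℕ} (hN : 0 < N) (m : ℕ) : Fin N :=
  ⟨N - 1 - m, by omega⟩

/-- `max_i a_i / p_i`. -/
def maxRatio {N : ℕ} (a p : Fin N → ℝ) : ℝ :=
  ⨆ i, a i / p i

/-- `∑_i (2ϱε_i)^{cϱ s p_i / T_i}`, where `s = max_i T_i / p_i` and the sum is over all but the last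
`m` indices of `Fin N`. -/
def tailSum (D : DistKind) {N : ℕ} (ε p T : Fin N → ℝ) (c : ℝ) (m : ℕ) : ℝ :=
  ∑ i with i.val + m < N, (2 * rho D * ε i) ^ (c * rho D * maxRatio T p * p i / T i)

/-- `R(c) = 0`, where `R(c) = lim_{m → ∞} limsup_{n → ∞} tailSum`, a limit in `[0, ∞]`. -/
def TailVanishes (D : DistKind) {k : ℕ → ℕ} (ε p T : ∀ n, Fin (k n) → ℝ) (c : ℝ) : Prop :=
  Tendsto (fun m : ℕ =>
      limsup (fun n : ℕ => ENNReal.ofReal (tailSum D (ε n) (p n) (T n) c m)) atTop)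
    atTop (𝓝 0)

end

end ProductChain

open ProductChain

/-!
Write `ϱ` for `rho D`. For both distances `1 - d ^ ϱ` is an affinity `∑ₓ overlap (μ x) (ν x)`, and
affinities of products dominate products of affinities. Since the heat kernel of the product chain
at time `q t` is the tensor product of the coordinate heat kernels at the times `pᵢ t`, the distance
of the product is at least that of each coordinate, and its `ϱ`-th power is at most
`1 - ∏ᵢ (1 - dᵢ ^ ϱ)`. Submultiplicativity `d (s + t) ≤ 2 ϱ d s d t` gives the exponential decay
`d t ≤ (2 ϱ ε) ^ (t / T - 1)`, so that smallness of the tail sums makes the contribution of all but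
the last `m` coordinates negligible. Cutoffs of the product are thereby decided by boundedly many
coordinates at the end.
-/

namespace ProductChain

noncomputable section

universe u v

variable {X : Type u} {Y : Type v}

/-! ### Probabilities and stochastic kernels on a discrete space -/

/-- `μ` is a probability mass function. -/
structure IsProb (μ : X → ℝ) : Prop where
  nonneg : ∀ x, 0 ≤ μ x
  hasSum : HasSum μ 1

/-- `P` is a stochastic kernel: every row `P x` is a probability mass function. -/
def IsStochastic (P : X → Y → ℝ) : Prop :=
  ∀ x, IsProb (P x)

/-- The image `μ P` of the mass function `μ` under the kernel `P`. -/
def push (μ : X → ℝ) (P : X → Y → ℝ) (y : Y) : ℝ :=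
  ∑' x, μ x * P x y

theorem summable_and_hasSum_tsum_swap {f : X → Y → ℝ} {g : X → ℝ} {a : ℝ}
    (hf : ∀ x y, 0 ≤ f x y) (hfg : ∀ x, HasSum (f x) (g x)) (hg : HasSum g a) :
    (∀ y, Summable fun x => f x y) ∧ HasSum (fun y => ∑' x, f x y) a := by
  have hs : Summable fun z : X × Y => f z.1 z.2 := by
    rw [summable_prod_of_nonneg fun z => hf z.1 z.2]
    exact ⟨fun x => (hfg x).summable, by simpa only [(hfg _).tsum_eq] using hg.summable⟩
  have hs' : Summable fun z : Y × X => f z.2 z.1 := hs.prod_symm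
  have ha : ∑' y, ∑' x, f x y = a :=
    (Summable.tsum_comm (f := f) hs).trans <| by simpa only [(hfg _).tsum_eq] using hg.tsum_eq
  exact ⟨hs'.prod_factor, ha ▸ hs'.prod.hasSum⟩

theorem summable_and_tsum_tsum_mul_le {f : X → ℝ} {g : X → Y → ℝ} {G : X → ℝ} {M C : ℝ}
    (hf : ∀ x, 0 ≤ f x) (hfM : HasSum f M) (hg : ∀ x y, 0 ≤ g x y)
    (hgG : ∀ x, HasSum (g x) (G x)) (hGC : ∀ x, G x ≤ C) :
    (∀ y, Summable fun x => f x * g x y) ∧ Summable (fun y => ∑' x, f x * g x y) ∧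
      ∑' y, ∑' x, f x * g x y ≤ M * C := by
  have hle : ∀ x, f x * G x ≤ f x * C := fun x => mul_le_mul_of_nonneg_left (hGC x) (hf x)
  have hs : Summable fun x => f x * G x :=
    .of_nonneg_of_le (fun x => mul_nonneg (hf x) ((hgG x).nonneg (hg x))) hle
      (hfM.mul_right C).summable
  obtain ⟨hcol, hsum⟩ := summable_and_hasSum_tsum_swap
    (fun x y => mul_nonneg (hf x) (hg x y)) (fun x => (hgG x).mul_left (f x)) hs.hasSum
  exact ⟨hcol, hsum.summable, hsum.tsum_eq.trans_le (hasSum_le hle hs.hasSum (hfM.mul_right C))⟩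

namespace IsProb

variable {μ ν : X → ℝ} {P : X → Y → ℝ}

theorem summable (hμ : IsProb μ) : Summable μ :=
  hμ.hasSum.summable

theorem le_one (hμ : IsProb μ) (x : X) : μ x ≤ 1 :=
  le_hasSum hμ.hasSum x fun y _ => hμ.nonneg y

theorem summable_mul (hμ : IsProb μ) (hP : IsStochastic P) (y : Y) :
    Summable fun x => μ x * P x y :=
  .of_nonneg_of_le (fun x => mul_nonneg (hμ.nonneg x) ((hP x).nonneg y))
    (fun x => mul_le_of_le_one_right (hμ.nonneg x) ((hP x).le_one y)) hμ.summable

theorem push (hμ : IsProb μ) (hP : IsStochastic P) : IsProb (push μ P) where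
  nonneg y := tsum_nonneg fun x => mul_nonneg (hμ.nonneg x) ((hP x).nonneg y)
  hasSum := (summable_and_hasSum_tsum_swap (f := fun x y => μ x * P x y) (g := μ)
    (fun x y => mul_nonneg (hμ.nonneg x) ((hP x).nonneg y))
    (fun x => by simpa only [mul_one] using (hP x).hasSum.mul_left (μ x)) hμ.hasSum).2

end IsProb

theorem hasSum_push_sub_push {μ ν : X → ℝ} {P : X → Y → ℝ} (hμ : IsProb μ) (hν : IsProb ν)
    (hP : IsStochastic P) (y : Y) (c : ℝ) :
    HasSum (fun x => (μ x - ν x) * (P x y - c)) (push μ P y - push ν P y) := by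
  have h := ((hμ.summable_mul hP y).hasSum.sub (hν.summable_mul hP y).hasSum).sub
    ((hμ.hasSum.sub hν.hasSum).mul_right c)
  rw [sub_self, zero_mul, sub_zero] at h
  exact h.congr_fun fun x => by ring

theorem isStochastic_idKernel : IsStochastic (idKernel : X → X → ℝ) := fun x => by
  classical
  refine ⟨fun y => by unfold idKernel; split_ifs <;> norm_num, ?_⟩
  simpa [idKernel] using hasSum_single (f := idKernel x) x fun y hy => by simp [idKernel, hy.symm]

theorem push_idKernel (μ : X → ℝ) : push μ idKernel = μ := by
  ext y
  rw [push, tsum_eq_single y fun x hx => by simp [idKernel, hx]]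
  simp [idKernel]

theorem push_of_idKernel (P : X → Y → ℝ) (x : X) : push (idKernel x) P = P x := by
  ext y
  rw [push, tsum_eq_single x fun z hz => by simp [idKernel, hz.symm]]
  simp [idKernel]

/-! ### Overlap and affinity -/

/-- The pointwise overlap of two mass functions: the minimum for total variation, the geometric mean
for Hellinger. -/
def overlap : DistKind → ℝ → ℝ → ℝ
  | DistKind.TV, a, b => min a b
  | DistKind.H, a, b => √a * √b

/-- The affinity `∑ₓ overlap (μ x) (ν x)`, which is one minus the `ϱ`-th power of the distance. -/
def affinity (D : DistKind) (μ ν : X → ℝ) : ℝ :=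
  ∑' x, overlap D (μ x) (ν x)

theorem rho_pos (D : DistKind) : 0 < rho D := by
  cases D <;> norm_num [rho]

theorem overlap_nonneg (D : DistKind) {a b : ℝ} (ha : 0 ≤ a) (hb : 0 ≤ b) :
    0 ≤ overlap D a b := by
  cases D
  · exact le_min ha hb
  · exact mul_nonneg (Real.sqrt_nonneg _) (Real.sqrt_nonneg _)

theorem overlap_le_add (D : DistKind) {a b : ℝ} (ha : 0 ≤ a) (hb : 0 ≤ b) :
    overlap D a b ≤ a + b := by
  cases D
  · exact (min_le_left a b).trans (le_add_of_nonneg_right hb)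
  · simp only [overlap]
    nlinarith [Real.sq_sqrt ha, Real.sq_sqrt hb, sq_nonneg (√a - √b), Real.sqrt_nonneg a,
      Real.sqrt_nonneg b]

theorem overlap_mul_right (D : DistKind) {a b c : ℝ} (hc : 0 ≤ c) :
    overlap D (a * c) (b * c) = overlap D a b * c := by
  cases D
  · exact (min_mul_of_nonneg _ _ hc).symm
  · simp only [overlap, Real.sqrt_mul' _ hc]
    linear_combination √a * √b * Real.mul_self_sqrt hc

theorem prod_overlap_le (D : DistKind) {ι : Type v} (s : Finset ι) {a b : ι → ℝ}
    (ha : ∀ i, 0 ≤ a i) (hb : ∀ i, 0 ≤ b i) :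
    ∏ i ∈ s, overlap D (a i) (b i) ≤ overlap D (∏ i ∈ s, a i) (∏ i ∈ s, b i) := by
  cases D
  · have h : ∀ i ∈ s, 0 ≤ min (a i) (b i) := fun i _ => le_min (ha i) (hb i)
    exact le_min (Finset.prod_le_prod h fun i _ => min_le_left _ _)
      (Finset.prod_le_prod h fun i _ => min_le_right _ _)
  · simp only [overlap, Finset.prod_mul_distrib]
    rw [Real.sqrt_prod _ fun i _ => ha i, Real.sqrt_prod _ fun i _ => hb i]

theorem summable_and_tsum_sqrt_mul_sqrt_le {f g : X → ℝ} (hf : ∀ x, 0 ≤ f x) (hg : ∀ x, 0 ≤ g x)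
    (hfs : Summable f) (hgs : Summable g) :
    Summable (fun x => √(f x) * √(g x)) ∧
      ∑' x, √(f x) * √(g x) ≤ √(∑' x, f x) * √(∑' x, g x) := by
  have h := Real.summable_and_inner_le_Lp_mul_Lq_tsum_of_nonneg Real.HolderConjugate.two_two
    (f := fun x => √(f x)) (g := fun x => √(g x))
    (fun x => Real.sqrt_nonneg _) (fun x => Real.sqrt_nonneg _)
    (by simpa [Real.sq_sqrt (hf _)] using hfs) (by simpa [Real.sq_sqrt (hg _)] using hgs)
  refine ⟨h.1, h.2.trans_eq ?_⟩
  simp only [Real.rpow_two, Real.sq_sqrt (hf _), Real.sq_sqrt (hg _), ← Real.sqrt_eq_rpow]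

theorem summable_overlap (D : DistKind) {f g : X → ℝ} (hf : ∀ x, 0 ≤ f x)
    (hg : ∀ x, 0 ≤ g x) (hfs : Summable f) (hgs : Summable g) :
    Summable fun x => overlap D (f x) (g x) :=
  .of_nonneg_of_le (fun x => overlap_nonneg D (hf x) (hg x))
    (fun x => overlap_le_add D (hf x) (hg x)) (hfs.add hgs)

theorem tsum_overlap_le (D : DistKind) {f g : X → ℝ} (hf : ∀ x, 0 ≤ f x)
    (hg : ∀ x, 0 ≤ g x) (hfs : Summable f) (hgs : Summable g) :
    ∑' x, overlap D (f x) (g x) ≤ overlap D (∑' x, f x) (∑' x, g x) := by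
  have hs := summable_overlap D hf hg hfs hgs
  cases D
  · exact le_min (hs.tsum_le_tsum (fun x => min_le_left _ _) hfs)
      (hs.tsum_le_tsum (fun x => min_le_right _ _) hgs)
  · exact (summable_and_tsum_sqrt_mul_sqrt_le hf hg hfs hgs).2

section Affinity

variable (D : DistKind) {μ ν : X → ℝ}

theorem hasSum_overlap (hμ : IsProb μ) (hν : IsProb ν) :
    HasSum (fun x => overlap D (μ x) (ν x)) (affinity D μ ν) :=
  (summable_overlap D hμ.nonneg hν.nonneg hμ.summable hν.summable).hasSum

theorem affinity_nonneg (hμ : IsProb μ) (hν : IsProb ν) : 0 ≤ affinity D μ ν :=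
  tsum_nonneg fun x => overlap_nonneg D (hμ.nonneg x) (hν.nonneg x)

theorem affinity_le_one (hμ : IsProb μ) (hν : IsProb ν) : affinity D μ ν ≤ 1 := by
  refine (tsum_overlap_le D hμ.nonneg hν.nonneg hμ.summable hν.summable).trans ?_
  rw [hμ.hasSum.tsum_eq, hν.hasSum.tsum_eq]
  cases D <;> simp [overlap]

theorem affinity_le_affinity_push {P : X → Y → ℝ} (hμ : IsProb μ) (hν : IsProb ν)
    (hP : IsStochastic P) : affinity D μ ν ≤ affinity D (push μ P) (push ν P) := by
  have hcol (y : Y) : ∑' x, overlap D (μ x) (ν x) * P x y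
      ≤ overlap D (push μ P y) (push ν P y) := by
    simpa only [overlap_mul_right D ((hP _).nonneg y), push] using
      tsum_overlap_le D (fun x => mul_nonneg (hμ.nonneg x) ((hP x).nonneg y))
        (fun x => mul_nonneg (hν.nonneg x) ((hP x).nonneg y)) (hμ.summable_mul hP y)
        (hν.summable_mul hP y)
  exact hasSum_le hcol (summable_and_hasSum_tsum_swap
    (fun x y => mul_nonneg (overlap_nonneg D (hμ.nonneg x) (hν.nonneg x)) ((hP x).nonneg y))
    (fun x => by simpa only [mul_one] using (hP x).hasSum.mul_left (overlap D (μ x) (ν x)))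
    (hasSum_overlap D hμ hν)).2 (hasSum_overlap D (hμ.push hP) (hν.push hP))

end Affinity

/-! ### Total variation and Hellinger distances -/

section Distance

variable {μ ν : X → ℝ}

theorem hasSum_sub_overlap_TV (hμ : IsProb μ) (hν : IsProb ν) :
    HasSum (fun x => μ x - overlap DistKind.TV (μ x) (ν x)) (1 - affinity DistKind.TV μ ν) :=
  hμ.hasSum.sub (hasSum_overlap DistKind.TV hμ hν)

theorem tvDist_eq (hμ : IsProb μ) (hν : IsProb ν) :
    tvDist μ ν = 1 - affinity DistKind.TV μ ν := by
  have hpos := hasSum_sub_overlap_TV hμ hν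
  have hdiff (A : Set X) : (∑' y : A, μ y) - (∑' y : A, ν y)
      = ∑' y, A.indicator (fun y => μ y - ν y) y :=
    ((hμ.summable.subtype A).tsum_sub (hν.summable.subtype A)).symm.trans
      (tsum_subtype A fun y => μ y - ν y)
  have hle (A : Set X) :
      (∑' y : A, μ y) - (∑' y : A, ν y) ≤ 1 - affinity DistKind.TV μ ν := by
    rw [hdiff, ← hpos.tsum_eq]
    refine ((hμ.summable.sub hν.summable).indicator A).tsum_le_tsum (fun y => ?_) hpos.summable
    by_cases hy : y ∈ A
    · simpa only [Set.indicator_of_mem hy, overlap] using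
        sub_le_sub_left (min_le_right (μ y) (ν y)) _
    · simpa only [Set.indicator_of_notMem hy, overlap, sub_nonneg] using min_le_left (μ y) (ν y)
  refine le_antisymm (ciSup_le hle) ?_
  -- The supremum is attained at `A = {ν ≤ μ}`.
  refine le_ciSup_of_le ⟨_, Set.forall_mem_range.2 hle⟩ {y | ν y ≤ μ y} ?_
  rw [hdiff, ← hpos.tsum_eq]
  refine (tsum_congr fun y => ?_).le
  by_cases hy : ν y ≤ μ y
  · simp [overlap, hy]
  · simp [overlap, hy, (not_le.1 hy).le]

theorem sub_le_tvDist (hμ : IsProb μ) (hν : IsProb ν) (x : X) : μ x - ν x ≤ tvDist μ ν := by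
  rw [tvDist_eq hμ hν]
  have h := le_hasSum (hasSum_sub_overlap_TV hμ hν) x fun y _ => sub_nonneg.2 (min_le_left _ _)
  exact (sub_le_sub_left (min_le_right _ _) _).trans h

theorem hasSum_abs_sub (hμ : IsProb μ) (hν : IsProb ν) :
    HasSum (fun x => |μ x - ν x|) (2 * tvDist μ ν) := by
  have h := (hμ.hasSum.add hν.hasSum).sub ((hasSum_overlap DistKind.TV hμ hν).mul_left 2)
  rw [show 1 + 1 - 2 * affinity DistKind.TV μ ν = 2 * tvDist μ ν by rw [tvDist_eq hμ hν]; ring] at h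
  refine h.congr_fun fun x => ?_
  rw [← max_sub_min_eq_abs', overlap]
  linear_combination max_add_min (μ x) (ν x)

theorem hasSum_sq_sqrt_sub_sqrt (hμ : IsProb μ) (hν : IsProb ν) :
    HasSum (fun x => (√(μ x) - √(ν x)) ^ 2) (2 * (1 - affinity DistKind.H μ ν)) := by
  have h := (hμ.hasSum.add hν.hasSum).sub ((hasSum_overlap DistKind.H hμ hν).mul_left 2)
  rw [show 1 + 1 - 2 * affinity DistKind.H μ ν = 2 * (1 - affinity DistKind.H μ ν) by ring] at h
  refine h.congr_fun fun x => ?_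
  rw [overlap]
  linear_combination Real.sq_sqrt (hμ.nonneg x) + Real.sq_sqrt (hν.nonneg x)

theorem hellingerDist_sq (hμ : IsProb μ) (hν : IsProb ν) :
    hellingerDist μ ν ^ 2 = 1 - affinity DistKind.H μ ν := by
  rw [hellingerDist, (hasSum_sq_sqrt_sub_sqrt hμ hν).tsum_eq, one_div,
    inv_mul_cancel_left₀ two_ne_zero,
    Real.sq_sqrt (sub_nonneg.2 (affinity_le_one DistKind.H hμ hν))]

theorem probDist_nonneg (D : DistKind) (hμ : IsProb μ) (hν : IsProb ν) : 0 ≤ probDist D μ ν := by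
  cases D
  · exact (sub_nonneg.2 (affinity_le_one DistKind.TV hμ hν)).trans_eq (tvDist_eq hμ hν).symm
  · exact Real.sqrt_nonneg _

theorem probDist_rpow_rho (D : DistKind) (hμ : IsProb μ) (hν : IsProb ν) :
    probDist D μ ν ^ rho D = 1 - affinity D μ ν := by
  cases D
  · simpa only [probDist, rho, Real.rpow_one] using tvDist_eq hμ hν
  · simpa only [probDist, rho, Real.rpow_two] using hellingerDist_sq hμ hν

theorem probDist_le_one (D : DistKind) (hμ : IsProb μ) (hν : IsProb ν) : probDist D μ ν ≤ 1 := by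
  rw [← Real.rpow_le_rpow_iff (probDist_nonneg D hμ hν) zero_le_one (rho_pos D),
    probDist_rpow_rho D hμ hν, Real.one_rpow, sub_le_self_iff]
  exact affinity_nonneg D hμ hν

theorem probDist_le_probDist_iff (D : DistKind) {μ' ν' : Y → ℝ} (hμ : IsProb μ) (hν : IsProb ν)
    (hμ' : IsProb μ') (hν' : IsProb ν') :
    probDist D μ ν ≤ probDist D μ' ν' ↔ affinity D μ' ν' ≤ affinity D μ ν := by
  rw [← Real.rpow_le_rpow_iff (probDist_nonneg D hμ hν) (probDist_nonneg D hμ' hν') (rho_pos D),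
    probDist_rpow_rho D hμ hν, probDist_rpow_rho D hμ' hν', sub_le_sub_iff_left]

theorem probDist_push_le (D : DistKind) {P : X → Y → ℝ} (hμ : IsProb μ) (hν : IsProb ν)
    (hP : IsStochastic P) : probDist D (push μ P) (push ν P) ≤ probDist D μ ν :=
  (probDist_le_probDist_iff D (hμ.push hP) (hν.push hP) hμ hν).2
    (affinity_le_affinity_push D hμ hν hP)

theorem affinity_H_sq_le (hμ : IsProb μ) (hν : IsProb ν) :
    affinity DistKind.H μ ν ^ 2
      ≤ affinity DistKind.TV μ ν * (2 - affinity DistKind.TV μ ν) := by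
  have hmin := hasSum_overlap DistKind.TV hμ hν
  have hmax : HasSum (fun x => max (μ x) (ν x)) (2 - affinity DistKind.TV μ ν) := by
    rw [← one_add_one_eq_two]
    exact ((hμ.hasSum.add hν.hasSum).sub hmin).congr_fun fun x =>
      eq_sub_of_add_eq (max_add_min _ _)
  have hmin_nonneg x := overlap_nonneg DistKind.TV (hμ.nonneg x) (hν.nonneg x)
  have hmax_nonneg x : 0 ≤ max (μ x) (ν x) := (hμ.nonneg x).trans (le_max_left _ _)
  have hmul x : overlap DistKind.H (μ x) (ν x)
      = √(overlap DistKind.TV (μ x) (ν x)) * √(max (μ x) (ν x)) := by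
    rw [← Real.sqrt_mul (hmin_nonneg x), overlap, overlap, min_mul_max,
      Real.sqrt_mul (hμ.nonneg x)]
  have hCS := (summable_and_tsum_sqrt_mul_sqrt_le hmin_nonneg hmax_nonneg hmin.summable
    hmax.summable).2
  rw [← tsum_congr hmul, hmin.tsum_eq, hmax.tsum_eq,
    ← Real.sqrt_mul (affinity_nonneg DistKind.TV hμ hν)] at hCS
  exact (Real.le_sqrt (affinity_nonneg _ hμ hν)
    (mul_nonneg (affinity_nonneg _ hμ hν) (hmax.nonneg hmax_nonneg))).1 hCS

theorem tvDist_le_rho_mul_probDist (D : DistKind) (hμ : IsProb μ) (hν : IsProb ν) :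
    tvDist μ ν ≤ rho D * probDist D μ ν := by
  cases D
  · simp only [rho, probDist, one_mul, le_refl]
  · have hsq := affinity_H_sq_le hμ hν
    have hle := affinity_le_one DistKind.H hμ hν
    have hd : 0 ≤ rho DistKind.H * probDist DistKind.H μ ν :=
      mul_nonneg (rho_pos _).le (probDist_nonneg _ hμ hν)
    refine le_of_sq_le_sq ?_ hd
    simp only [rho, probDist]
    rw [mul_pow, hellingerDist_sq hμ hν, tvDist_eq hμ hν]
    nlinarith [affinity_nonneg DistKind.H hμ hν]

end Distance

/-! ### Submultiplicativity of the distance to stationarity -/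

theorem abs_tsum_le_tsum_abs {f : X → ℝ} (hf : Summable fun x => |f x|) :
    |∑' x, f x| ≤ ∑' x, |f x| := by
  simpa only [Real.norm_eq_abs] using norm_tsum_le_tsum_norm (f := f) hf

theorem summable_and_sq_tsum_mul_le {f g : X → ℝ} (hf : Summable fun x => f x ^ 2)
    (hg : Summable fun x => g x ^ 2) :
    Summable (fun x => f x * g x) ∧
      (∑' x, f x * g x) ^ 2 ≤ (∑' x, f x ^ 2) * ∑' x, g x ^ 2 := by
  obtain ⟨hs, hle⟩ := summable_and_tsum_sqrt_mul_sqrt_le (fun x => sq_nonneg (f x))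
    (fun x => sq_nonneg (g x)) hf hg
  simp only [Real.sqrt_sq_eq_abs, ← abs_mul] at hs hle
  refine ⟨hs.of_abs, ?_⟩
  have habs : |∑' x, f x * g x| ≤ √(∑' x, f x ^ 2) * √(∑' x, g x ^ 2) :=
    (abs_tsum_le_tsum_abs hs).trans hle
  rw [← Real.sqrt_mul (tsum_nonneg fun x => sq_nonneg _)] at habs
  rw [← sq_abs]
  exact (Real.le_sqrt (abs_nonneg _) (mul_nonneg (tsum_nonneg fun x => sq_nonneg _)
    (tsum_nonneg fun x => sq_nonneg _))).1 habs

theorem summable_and_tsum_sq_sqrt_add_sqrt_le {f g : X → ℝ} (hf : ∀ x, 0 ≤ f x)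
    (hg : ∀ x, 0 ≤ g x) (hfs : Summable f) (hgs : Summable g) :
    Summable (fun x => (√(f x) + √(g x)) ^ 2) ∧
      ∑' x, (√(f x) + √(g x)) ^ 2 ≤ (√(∑' x, f x) + √(∑' x, g x)) ^ 2 := by
  obtain ⟨hs, hle⟩ := summable_and_tsum_sqrt_mul_sqrt_le hf hg hfs hgs
  have h := ((hfs.hasSum.add hgs.hasSum).add (hs.hasSum.mul_left 2)).congr_fun
    (g := fun x => (√(f x) + √(g x)) ^ 2) fun x => by
      rw [add_sq, Real.sq_sqrt (hf x), Real.sq_sqrt (hg x)]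
      ring
  refine ⟨h.summable, ?_⟩
  rw [h.tsum_eq, add_sq, Real.sq_sqrt (tsum_nonneg hf), Real.sq_sqrt (tsum_nonneg hg)]
  linarith

section Submultiplicativity

variable {μ ν : X → ℝ} {P : X → Y → ℝ}

theorem tvDist_push_le_mul (hμ : IsProb μ) (hν : IsProb ν) (hP : IsStochastic P) {δ : ℝ}
    (hδ : ∀ x, tvDist (P x) (push ν P) ≤ δ) :
    tvDist (push μ P) (push ν P) ≤ 2 * tvDist μ ν * δ := by
  obtain ⟨hcol, hs, hle⟩ := summable_and_tsum_tsum_mul_le (fun x => abs_nonneg (μ x - ν x))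
    (hasSum_abs_sub hμ hν) (fun x y => abs_nonneg (P x y - push ν P y))
    (fun x => hasSum_abs_sub (hP x) (hν.push hP))
    (fun x => mul_le_mul_of_nonneg_left (hδ x) zero_le_two)
  have habs (y : Y) : |push μ P y - push ν P y| ≤ ∑' x, |μ x - ν x| * |P x y - push ν P y| := by
    simp only [← abs_mul] at hcol ⊢
    rw [← (hasSum_push_sub_push hμ hν hP y (push ν P y)).tsum_eq]
    exact abs_tsum_le_tsum_abs (hcol y)
  linarith [hasSum_le habs (hasSum_abs_sub (hμ.push hP) (hν.push hP)) hs.hasSum]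

theorem summable_and_tsum_sq_sqrt_add_sqrt_mul_sqrt_le {f : X → ℝ} (hμ : IsProb μ) (hν : IsProb ν)
    (hf : ∀ x, 0 ≤ f x) (hμf : Summable fun x => μ x * f x) (hνf : Summable fun x => ν x * f x) :
    Summable (fun x => (√(μ x) + √(ν x)) ^ 2 * √(f x)) ∧
      ∑' x, (√(μ x) + √(ν x)) ^ 2 * √(f x)
        ≤ 3 * √(∑' x, μ x * f x) + √(∑' x, ν x * f x) := by
  have hμf0 x : 0 ≤ μ x * f x := mul_nonneg (hμ.nonneg x) (hf x)
  have hνf0 x : 0 ≤ ν x * f x := mul_nonneg (hν.nonneg x) (hf x)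
  obtain ⟨hs₁, hle₁⟩ := summable_and_tsum_sqrt_mul_sqrt_le hμ.nonneg hμf0 hμ.summable hμf
  obtain ⟨hs₂, hle₂⟩ := summable_and_tsum_sqrt_mul_sqrt_le hν.nonneg hνf0 hν.summable hνf
  obtain ⟨hs₃, hle₃⟩ := summable_and_tsum_sqrt_mul_sqrt_le hν.nonneg hμf0 hν.summable hμf
  rw [hμ.hasSum.tsum_eq, Real.sqrt_one, one_mul] at hle₁
  rw [hν.hasSum.tsum_eq, Real.sqrt_one, one_mul] at hle₂ hle₃
  have h := ((hs₁.hasSum.add hs₂.hasSum).add (hs₃.hasSum.mul_left 2)).congr_fun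
    (g := fun x => (√(μ x) + √(ν x)) ^ 2 * √(f x)) fun x => by
      rw [Real.sqrt_mul (hμ.nonneg x), Real.sqrt_mul (hν.nonneg x)]
      ring
  refine ⟨h.summable, ?_⟩
  rw [h.tsum_eq]
  linarith

theorem summable_and_tsum_sq_sqrt_add_sqrt_mul_sq_le (hμ : IsProb μ) (hν : IsProb ν)
    (hP : IsStochastic P) (y : Y) :
    Summable (fun x => ((√(μ x) + √(ν x)) * (√(P x y) + √(push ν P y))) ^ 2) ∧
      ∑' x, ((√(μ x) + √(ν x)) * (√(P x y) + √(push ν P y))) ^ 2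
        ≤ 7 * (√(push μ P y) + √(push ν P y)) ^ 2 := by
  have hP0 x := (hP x).nonneg y
  obtain ⟨hs₂, hle₂⟩ := summable_and_tsum_sq_sqrt_add_sqrt_le
    (fun x => mul_nonneg (hμ.nonneg x) (hP0 x)) (fun x => mul_nonneg (hν.nonneg x) (hP0 x))
    (hμ.summable_mul hP y) (hν.summable_mul hP y)
  obtain ⟨hs₁, hle₁⟩ := summable_and_tsum_sq_sqrt_add_sqrt_mul_sqrt_le hμ hν hP0
    (hμ.summable_mul hP y) (hν.summable_mul hP y)
  obtain ⟨hs₀, hle₀⟩ := summable_and_tsum_sq_sqrt_add_sqrt_le hμ.nonneg hν.nonneg hμ.summable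
    hν.summable
  rw [hμ.hasSum.tsum_eq, hν.hasSum.tsum_eq, Real.sqrt_one] at hle₀
  change _ ≤ 3 * √(push μ P y) + √(push ν P y) at hle₁
  change _ ≤ (√(push μ P y) + √(push ν P y)) ^ 2 at hle₂
  set A := √(push μ P y)
  set B := √(push ν P y)
  have hA : 0 ≤ A := Real.sqrt_nonneg _
  have hB : 0 ≤ B := Real.sqrt_nonneg _
  have h := ((hs₂.hasSum.add (hs₁.hasSum.mul_left (2 * B))).add
    (hs₀.hasSum.mul_left (B ^ 2))).congr_fun
    (g := fun x => ((√(μ x) + √(ν x)) * (√(P x y) + B)) ^ 2) fun x => by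
      rw [Real.sqrt_mul (hμ.nonneg x), Real.sqrt_mul (hν.nonneg x)]
      ring
  refine ⟨h.summable, h.tsum_eq.trans_le ?_⟩
  calc _ ≤ (A + B) ^ 2 + 2 * B * (3 * A + B) + B ^ 2 * (1 + 1) ^ 2 := by gcongr
    _ ≤ 7 * (A + B) ^ 2 := by nlinarith [mul_nonneg hA hB, mul_nonneg hA hA]

theorem sq_sqrt_push_sub_sqrt_push_le (hμ : IsProb μ) (hν : IsProb ν) (hP : IsStochastic P) (y : Y)
    (hs : Summable fun x => (√(μ x) - √(ν x)) ^ 2 * (√(P x y) - √(push ν P y)) ^ 2) :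
    (√(push μ P y) - √(push ν P y)) ^ 2
      ≤ 7 * ∑' x, (√(μ x) - √(ν x)) ^ 2 * (√(P x y) - √(push ν P y)) ^ 2 := by
  simp only [← mul_pow] at hs ⊢
  have hsub {a b : ℝ} (ha : 0 ≤ a) (hb : 0 ≤ b) : (√a - √b) * (√a + √b) = a - b := by
    linear_combination Real.sq_sqrt ha - Real.sq_sqrt hb
  have hμP := (hμ.push hP).nonneg y
  have hνP := (hν.push hP).nonneg y
  obtain ⟨hs', hle⟩ := summable_and_tsum_sq_sqrt_add_sqrt_mul_sq_le hμ hν hP y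
  -- Cauchy-Schwarz for `μ P - ν P = ∑ (μ - ν) (P - ν P)` and `a - b = (√a - √b) (√a + √b)`.
  have hCS := (summable_and_sq_tsum_mul_le hs hs').2
  rw [((hasSum_push_sub_push hμ hν hP y (push ν P y)).congr_fun fun x => by
    rw [mul_mul_mul_comm, hsub (hμ.nonneg x) (hν.nonneg x), hsub ((hP x).nonneg y) hνP]).tsum_eq,
    ← hsub hμP hνP] at hCS
  set S := ∑' x, ((√(μ x) - √(ν x)) * (√(P x y) - √(push ν P y))) ^ 2
  have hS : 0 ≤ S := tsum_nonneg fun x => sq_nonneg _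
  rcases (add_nonneg (Real.sqrt_nonneg (push μ P y)) (Real.sqrt_nonneg (push ν P y))).eq_or_lt'
    with h0 | h0
  · obtain ⟨hA, hB⟩ := (add_eq_zero_iff_of_nonneg (Real.sqrt_nonneg _) (Real.sqrt_nonneg _)).1 h0
    simpa [hA, hB] using hS
  · refine le_of_mul_le_mul_right ?_ (pow_pos h0 2)
    calc _ ≤ S * _ := by rw [← mul_pow]; exact hCS
      _ ≤ S * (7 * (√(push μ P y) + √(push ν P y)) ^ 2) := mul_le_mul_of_nonneg_left hle hS
      _ = _ := by ring

theorem hellingerDist_push_le_mul (hμ : IsProb μ) (hν : IsProb ν) (hP : IsStochastic P) {δ : ℝ}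
    (hδ0 : 0 ≤ δ) (hδ : ∀ x, hellingerDist (P x) (push ν P) ≤ δ) :
    hellingerDist (push μ P) (push ν P) ≤ 4 * hellingerDist μ ν * δ := by
  have hrow (x : X) : 2 * (1 - affinity DistKind.H (P x) (push ν P)) ≤ 2 * δ ^ 2 := by
    rw [← hellingerDist_sq (hP x) (hν.push hP)]
    gcongr
    exacts [Real.sqrt_nonneg _, hδ x]
  obtain ⟨hcol, hs, hle⟩ := summable_and_tsum_tsum_mul_le (fun x => sq_nonneg (√(μ x) - √(ν x)))
    (hasSum_sq_sqrt_sub_sqrt hμ hν) (fun x y => sq_nonneg (√(P x y) - √(push ν P y)))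
    (fun x => hasSum_sq_sqrt_sub_sqrt (hP x) (hν.push hP)) hrow
  have hsq := hasSum_le (fun y => sq_sqrt_push_sub_sqrt_push_le hμ hν hP y (hcol y))
    (hasSum_sq_sqrt_sub_sqrt (hμ.push hP) (hν.push hP)) (hs.hasSum.mul_left 7)
  rw [← hellingerDist_sq (hμ.push hP) (hν.push hP)] at hsq
  rw [← hellingerDist_sq hμ hν] at hle
  refine le_of_sq_le_sq ?_ (mul_nonneg (mul_nonneg zero_le_four (Real.sqrt_nonneg _)) hδ0)
  nlinarith [mul_nonneg (sq_nonneg (hellingerDist μ ν)) (sq_nonneg δ)]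

theorem probDist_push_le_mul (D : DistKind) (hμ : IsProb μ) (hν : IsProb ν) (hP : IsStochastic P)
    {δ : ℝ} (hδ0 : 0 ≤ δ) (hδ : ∀ x, probDist D (P x) (push ν P) ≤ δ) :
    probDist D (push μ P) (push ν P) ≤ 2 * rho D * probDist D μ ν * δ := by
  cases D
  · rw [rho, mul_one]
    exact tvDist_push_le_mul hμ hν hP hδ
  · rw [rho, two_mul, two_add_two_eq_four]
    exact hellingerDist_push_le_mul hμ hν hP hδ0 hδ

end Submultiplicativity

/-! ### Kernels as operators on `ℓ¹` -/

/-- The Banach space `ℓ¹(X)`, on which the Markov kernels on `X` act from the right. -/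
abbrev L1 (X : Type u) : Type u := lp (fun _ : X => ℝ) 1

namespace L1

theorem summable_norm (f : L1 X) : Summable fun x => ‖f x‖ := by
  simpa using (lp.memℓp f).summable (by simp)

theorem norm_eq (f : L1 X) : ‖f‖ = ∑' x, ‖f x‖ := by
  simpa using lp.norm_eq_tsum_rpow (p := 1) (by simp) f

/-- A summable function as an element of `ℓ¹(X)`. -/
def mk (f : X → ℝ) (hf : Summable f) : L1 X :=
  ⟨f, by apply memℓp_gen; simpa using hf.norm⟩

/-- The point mass at `x`. -/
def delta (x : X) : L1 X :=
  mk (idKernel x) (isStochastic_idKernel x).summable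

theorem hasSum_delta (f : L1 X) : HasSum (fun x => f x • delta x) f := by
  classical
  convert lp.hasSum_single (p := 1) (by simp) f using 2 with x
  ext y
  obtain rfl | hxy := eq_or_ne x y
  · simp [delta, mk, idKernel]
  · simp [delta, mk, idKernel, hxy, hxy.symm]

section lift

variable {E : Type v} [NormedAddCommGroup E] [NormedSpace ℝ E] {a : X → E}

theorem summable_norm_smul (ha : ∀ x, ‖a x‖ ≤ 1) (f : L1 X) : Summable fun x => ‖f x • a x‖ :=
  f.summable_norm.of_nonneg_of_le (fun _ => norm_nonneg _) fun x => by
    rw [norm_smul]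
    exact mul_le_of_le_one_right (norm_nonneg _) (ha x)

variable [CompleteSpace E]

/-- The operator on `ℓ¹(X)` whose values at the point masses are given by a family in the unit
ball of a Banach space. -/
def lift (a : X → E) (ha : ∀ x, ‖a x‖ ≤ 1) : L1 X →L[ℝ] E :=
  LinearMap.mkContinuous
    { toFun := fun f => ∑' x, f x • a x
      map_add' := fun f g => by
        rw [← (summable_norm_smul ha f).of_norm.tsum_add (summable_norm_smul ha g).of_norm]
        simp only [lp.coeFn_add, Pi.add_apply, add_smul]
      map_smul' := fun c f => by
        rw [RingHom.id_apply, ← (summable_norm_smul ha f).of_norm.tsum_const_smul c]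
        simp only [lp.coeFn_smul, Pi.smul_apply, smul_eq_mul, mul_smul] } 1
    fun f => by
      rw [one_mul, norm_eq]
      refine (norm_tsum_le_tsum_norm (summable_norm_smul ha f)).trans
        ((summable_norm_smul ha f).tsum_le_tsum (fun x => ?_) f.summable_norm)
      rw [norm_smul]
      exact mul_le_of_le_one_right (norm_nonneg _) (ha x)

theorem lift_delta (ha : ∀ x, ‖a x‖ ≤ 1) (x : X) : lift a ha (delta x) = a x := by
  change ∑' y, idKernel x y • a y = a x
  rw [tsum_eq_single x fun y hy => by simp [idKernel, hy.symm]]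
  simp [idKernel]

end lift

/-- The matrix entry `(δ_x A)(y)` of an operator `A` between `ℓ¹` spaces. -/
def entry (x : X) (y : Y) : (L1 X →L[ℝ] L1 Y) →L[ℝ] ℝ :=
  (lp.evalCLM ℝ (fun _ : Y => ℝ) 1 y).comp (ContinuousLinearMap.apply ℝ (L1 Y) (delta x))

theorem entry_apply (A : L1 X →L[ℝ] L1 Y) (x : X) (y : Y) : entry x y A = A (delta x) y := rfl

theorem hasSum_mul_entry (A : L1 X →L[ℝ] L1 Y) (f : L1 X) (y : Y) :
    HasSum (fun x => f x * entry x y A) (A f y) := by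
  refine ((hasSum_delta f).mapL A |>.mapL (lp.evalCLM ℝ (fun _ : Y => ℝ) 1 y)).congr_fun
    fun x => ?_
  rw [map_smul, map_smul]
  rfl

theorem ext_entry {A B : L1 X →L[ℝ] L1 Y} (h : ∀ x y, entry x y A = entry x y B) : A = B := by
  ext f y
  rw [← (hasSum_mul_entry A f y).tsum_eq, ← (hasSum_mul_entry B f y).tsum_eq]
  simp_rw [h]

theorem entry_one (x y : X) : entry x y (1 : L1 X →L[ℝ] L1 X) = idKernel x y := rfl

theorem entry_mul (A B : L1 X →L[ℝ] L1 X) (x y : X) :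
    entry x y (A * B) = push (fun z => entry x z B) (fun z w => entry z w A) y :=
  (hasSum_mul_entry A (B (delta x)) y).tsum_eq.symm

end L1

open L1

/-- The operator `μ ↦ μ P` of a stochastic matrix `P`. -/
def kernelOp (P : X → Y → ℝ) (hP : IsStochastic P) : L1 X →L[ℝ] L1 Y :=
  lift (fun x => L1.mk (P x) (hP x).summable) fun x => by
    rw [norm_eq]
    change ∑' y, ‖P x y‖ ≤ 1
    simp only [Real.norm_of_nonneg ((hP x).nonneg _), (hP x).hasSum.tsum_eq, le_refl]

theorem entry_kernelOp {P : X → Y → ℝ} (hP : IsStochastic P) (x : X) (y : Y) :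
    entry x y (kernelOp P hP) = P x y := by
  rw [entry_apply, kernelOp, lift_delta]
  rfl

theorem kernelOp_apply_mk {P : X → Y → ℝ} (hP : IsStochastic P) {f : X → ℝ} (hf : Summable f)
    (y : Y) : kernelOp P hP (L1.mk f hf) y = push f P y := by
  rw [← (hasSum_mul_entry _ _ y).tsum_eq]
  simp only [entry_kernelOp]
  rfl

theorem entry_kernelOp_pow {K : X → X → ℝ} (hK : IsStochastic K) (m : ℕ) (x y : X) :
    entry x y (kernelOp K hK ^ m) = kernelPow K m x y := by
  induction m generalizing x y with
  | zero => rfl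
  | succ m ih =>
    simp only [pow_succ, entry_mul, ih, entry_kernelOp]
    rfl

/-! ### The heat kernel -/

section exp

variable {𝔸 : Type u} [NormedRing 𝔸] [NormedAlgebra ℝ 𝔸] [CompleteSpace 𝔸]

theorem exp_add_of_commute {a b : 𝔸} (h : Commute a b) :
    NormedSpace.exp (a + b) = NormedSpace.exp a * NormedSpace.exp b :=
  let _ : NormedAlgebra ℚ 𝔸 := NormedAlgebra.restrictScalars ℚ ℝ 𝔸
  NormedSpace.exp_add_of_commute h

theorem exp_smul_sub_one (t : ℝ) (a : 𝔸) :
    NormedSpace.exp (t • (a - 1)) = Real.exp (-t) • NormedSpace.exp (t • a) := by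
  have hone : NormedSpace.exp ((-t) • (1 : 𝔸)) = Real.exp (-t) • 1 := by
    rw [← Algebra.algebraMap_eq_smul_one, ← Algebra.algebraMap_eq_smul_one,
      Real.exp_eq_exp_ℝ, NormedSpace.algebraMap_exp_comm]
  rw [show t • (a - 1) = (-t) • 1 + t • a by rw [smul_sub, neg_smul]; abel,
    exp_add_of_commute (((Commute.one_left a).smul_right t).smul_left (-t)), hone, smul_one_mul]

theorem exp_apply_eq_self {E : Type u} [NormedAddCommGroup E] [NormedSpace ℝ E] [CompleteSpace E]
    {A : E →L[ℝ] E} {v : E} (h : A v = 0) : NormedSpace.exp A v = v := by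
  have hsum := (NormedSpace.exp_series_hasSum_exp' (𝕂 := ℝ) A).mapL
    (ContinuousLinearMap.apply ℝ E v)
  refine hsum.unique ((hasSum_single 0 fun m hm => ?_).congr_fun fun _ => rfl) |>.trans ?_
  · obtain ⟨m, rfl⟩ := Nat.exists_eq_succ_of_ne_zero hm
    simp [pow_succ, h]
  · simp

end exp

/-- The operator `e^{-t(I-K)}` on `ℓ¹(X)`. -/
def heatOp (K : X → X → ℝ) (hK : IsStochastic K) (t : ℝ) : L1 X →L[ℝ] L1 X :=
  NormedSpace.exp (t • (kernelOp K hK - 1))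

variable {K : X → X → ℝ}

theorem entry_heatOp (hK : IsStochastic K) (t : ℝ) (x y : X) :
    entry x y (heatOp K hK t) = heatKernel K t x y := by
  have h := (NormedSpace.exp_series_hasSum_exp' (𝕂 := ℝ) (t • kernelOp K hK)).mapL (entry x y)
  rw [heatOp, exp_smul_sub_one, map_smul, smul_eq_mul, heatKernel, ← h.tsum_eq]
  congr 1
  refine tsum_congr fun m => ?_
  rw [smul_pow, smul_smul, map_smul, entry_kernelOp_pow, smul_eq_mul, div_eq_inv_mul]

theorem push_heatKernel_heatKernel (hK : IsStochastic K) (s t : ℝ) (x : X) :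
    push (heatKernel K s x) (heatKernel K t) = heatKernel K (s + t) x := by
  have hadd : heatOp K hK (s + t) = heatOp K hK t * heatOp K hK s := by
    rw [heatOp, add_comm s t, add_smul]
    exact exp_add_of_commute (((Commute.refl _).smul_left t).smul_right s)
  ext y
  rw [← entry_heatOp hK, hadd, entry_mul]
  simp only [entry_heatOp]

theorem push_heatKernel {π : X → ℝ} (hK : IsStochastic K) (hπ : IsProb π) (hstat : push π K = π)
    (t : ℝ) : push π (heatKernel K t) = π := by
  have hfix : heatOp K hK t (L1.mk π hπ.summable) = L1.mk π hπ.summable := by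
    refine exp_apply_eq_self ?_
    ext y
    change t * (kernelOp K hK (L1.mk π hπ.summable) y - π y) = 0
    rw [kernelOp_apply_mk, hstat, sub_self, mul_zero]
  ext y
  have hsum := (hasSum_mul_entry (heatOp K hK t) (L1.mk π hπ.summable) y).tsum_eq
  simp only [entry_heatOp, hfix] at hsum
  exact hsum

theorem isStochastic_kernelPow (hK : IsStochastic K) (m : ℕ) : IsStochastic (kernelPow K m) := by
  induction m with
  | zero => exact isStochastic_idKernel
  | succ m ih => exact fun x => (hK x).push ih

/-- The Poisson distribution with parameter `t`. -/
def poissonWeight (t : ℝ) (m : ℕ) : ℝ := Real.exp (-t) * (t ^ m / (m.factorial : ℝ))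

theorem isProb_poissonWeight {t : ℝ} (ht : 0 ≤ t) : IsProb (poissonWeight t) where
  nonneg m := by unfold poissonWeight; positivity
  hasSum := by
    have h := (NormedSpace.expSeries_div_hasSum_exp t).mul_left (Real.exp (-t))
    rwa [← Real.exp_eq_exp_ℝ, ← Real.exp_add, neg_add_cancel, Real.exp_zero] at h

theorem heatKernel_eq_push_poissonWeight (K : X → X → ℝ) (t : ℝ) (x : X) :
    heatKernel K t x = push (poissonWeight t) (fun m => kernelPow K m x) := by
  ext y
  simp only [heatKernel, push, poissonWeight, mul_assoc, tsum_mul_left]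

theorem isStochastic_heatKernel (hK : IsStochastic K) {t : ℝ} (ht : 0 ≤ t) :
    IsStochastic (heatKernel K t) := fun x => by
  rw [heatKernel_eq_push_poissonWeight]
  exact (isProb_poissonWeight ht).push fun m => isStochastic_kernelPow hK m x

theorem exp_neg_le_heatKernel_self (hK : IsStochastic K) {t : ℝ} (ht : 0 ≤ t) (x : X) :
    Real.exp (-t) ≤ heatKernel K t x x := by
  have hpow : IsStochastic fun m => kernelPow K m x := fun m => isStochastic_kernelPow hK m x
  rw [heatKernel_eq_push_poissonWeight]
  calc Real.exp (-t) = poissonWeight t 0 * kernelPow K 0 x x := by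
        simp [poissonWeight, kernelPow, idKernel]
    _ ≤ push (poissonWeight t) (fun m => kernelPow K m x) x :=
        ((isProb_poissonWeight ht).summable_mul hpow x).le_tsum 0 fun m _ =>
          mul_nonneg ((isProb_poissonWeight ht).nonneg m) ((hpow m).nonneg x)

/-! ### Tensor products of kernels -/

theorem hasSum_pi_prod_fin {N : ℕ} {X : Fin N → Type u} {f : ∀ i, X i → ℝ} {a : Fin N → ℝ}
    (hf : ∀ i x, 0 ≤ f i x) (h : ∀ i, HasSum (f i) (a i)) :
    HasSum (fun x : ∀ i, X i => ∏ i, f i (x i)) (∏ i, a i) := by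
  induction N with
  | zero => simp
  | succ N ih =>
    have htail := ih (fun i => hf i.succ) fun i => h i.succ
    have hsummable := (h 0).summable.mul_of_nonneg htail.summable (hf 0) fun x =>
      Finset.prod_nonneg fun i _ => hf i.succ (x i)
    rw [Fin.prod_univ_succ, ← (Fin.consEquiv X).hasSum_iff]
    refine ((h 0).mul htail hsummable).congr_fun fun z => ?_
    simp [Fin.prod_univ_succ, Fin.consEquiv]

theorem isStochastic_update_idKernel {ι : Type v} [DecidableEq ι] {X : ι → Type u} {i : ι}
    {A : X i → X i → ℝ} (hA : IsStochastic A) (j : ι) :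
    IsStochastic (Function.update (fun _ => idKernel) i A j) :=
  (Function.forall_update_iff _ fun _ B => IsStochastic B).2
    ⟨hA, fun _ _ => isStochastic_idKernel⟩ j

section tensor

variable {ι : Type v} [Fintype ι] {X : ι → Type u} {Y : ι → Type u}

theorem hasSum_pi_prod {f : ∀ i, X i → ℝ} {a : ι → ℝ} (hf : ∀ i x, 0 ≤ f i x)
    (h : ∀ i, HasSum (f i) (a i)) : HasSum (fun x : ∀ i, X i => ∏ i, f i (x i)) (∏ i, a i) := by
  let e := (Fintype.equivFin ι).symm
  rw [← e.prod_comp, ← (Equiv.piCongrLeft X e).hasSum_iff]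
  refine (hasSum_pi_prod_fin (fun j => hf (e j)) fun j => h (e j)).congr_fun fun x => ?_
  rw [Function.comp_apply, ← e.prod_comp]
  simp only [Equiv.piCongrLeft_apply_apply]

theorem isProb_prodPi {μ : ∀ i, X i → ℝ} (hμ : ∀ i, IsProb (μ i)) : IsProb (prodPi μ) where
  nonneg x := Finset.prod_nonneg fun i _ => (hμ i).nonneg (x i)
  hasSum := by
    have h := hasSum_pi_prod (fun i => (hμ i).nonneg) fun i => (hμ i).hasSum
    rwa [Finset.prod_const_one] at h

/-- The tensor product `A₁ ⊗ ⋯ ⊗ A_N` of kernels. -/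
def tensor (A : ∀ i, X i → Y i → ℝ) (x : ∀ i, X i) : (∀ i, Y i) → ℝ :=
  prodPi fun i => A i (x i)

theorem isStochastic_tensor {A : ∀ i, X i → Y i → ℝ} (hA : ∀ i, IsStochastic (A i)) :
    IsStochastic (tensor A) :=
  fun x => isProb_prodPi fun i => hA i (x i)

theorem push_prodPi_tensor {μ : ∀ i, X i → ℝ} {A : ∀ i, X i → Y i → ℝ} (hμ : ∀ i, IsProb (μ i))
    (hA : ∀ i, IsStochastic (A i)) :
    push (prodPi μ) (tensor A) = prodPi fun i => push (μ i) (A i) := by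
  ext y
  have h := hasSum_pi_prod (f := fun i x => μ i x * A i x (y i))
    (fun i x => mul_nonneg ((hμ i).nonneg x) ((hA i x).nonneg (y i)))
    fun i => ((hμ i).summable_mul (hA i) (y i)).hasSum
  simp_rw [Finset.prod_mul_distrib] at h
  exact h.tsum_eq

theorem idKernel_pi : idKernel (X := ∀ i, X i) = tensor fun _ => idKernel := by
  classical
  ext x y
  simp only [idKernel, tensor, prodPi, Finset.prod_ite_zero, Finset.prod_const_one,
    Finset.mem_univ, true_imp_iff, funext_iff]

variable [DecidableEq ι]

/-- The kernel `I ⊗ ⋯ ⊗ I ⊗ A ⊗ I ⊗ ⋯ ⊗ I` with `A` in the factor `i`. -/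
def coordKernel (i : ι) (A : X i → X i → ℝ) : (∀ j, X j) → (∀ j, X j) → ℝ :=
  tensor (Function.update (fun _ => idKernel) i A)

theorem isStochastic_coordKernel {i : ι} {A : X i → X i → ℝ} (hA : IsStochastic A) :
    IsStochastic (coordKernel i A) :=
  isStochastic_tensor (isStochastic_update_idKernel hA)

theorem coordKernel_eq_mul_prod_erase (i : ι) (A : X i → X i → ℝ) (x y : ∀ j, X j) :
    coordKernel i A x y = A (x i) (y i) * ∏ j ∈ Finset.univ.erase i, idKernel (x j) (y j) := by
  rw [coordKernel, tensor, prodPi, ← Finset.mul_prod_erase _ _ (Finset.mem_univ i),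
    Function.update_self]
  congr 1
  refine Finset.prod_congr rfl fun j hj => ?_
  rw [Function.update_of_ne (Finset.ne_of_mem_erase hj)]

theorem push_tensor_coordKernel {A : ∀ j, X j → X j → ℝ} (hA : ∀ j, IsStochastic (A j)) {i : ι}
    {B : X i → X i → ℝ} (hB : IsStochastic B) (x : ∀ j, X j) :
    push (tensor A x) (coordKernel i B)
      = tensor (Function.update A i fun z => push (A i z) B) x := by
  rw [coordKernel, tensor, push_prodPi_tensor (fun j => hA j (x j))
    (isStochastic_update_idKernel hB)]
  refine congrArg prodPi (funext fun j => ?_)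
  obtain rfl | hj := eq_or_ne j i
  · simp only [Function.update_self]
  · simp only [Function.update_of_ne hj, push_idKernel]

theorem push_coordKernel_self {i : ι} {A B : X i → X i → ℝ} (hA : IsStochastic A)
    (hB : IsStochastic B) (x : ∀ j, X j) :
    push (coordKernel i A x) (coordKernel i B) = coordKernel i (fun z => push (A z) B) x := by
  rw [coordKernel, push_tensor_coordKernel (isStochastic_update_idKernel hA) hB,
    Function.update_idem, Function.update_self]
  rfl

theorem kernelPow_coordKernel {i : ι} {A : X i → X i → ℝ} (hA : IsStochastic A) (m : ℕ) :
    kernelPow (coordKernel i A) m = coordKernel i (kernelPow A m) := by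
  induction m with
  | zero =>
    change idKernel = tensor (Function.update (fun _ => idKernel) i idKernel)
    rw [Function.update_eq_self i fun j => (idKernel : X j → X j → ℝ), idKernel_pi]
  | succ m ih =>
    ext x
    change push (coordKernel i A x) (kernelPow (coordKernel i A) m) _ = _
    rw [ih, push_coordKernel_self hA (isStochastic_kernelPow hA m)]
    rfl

theorem heatKernel_coordKernel {i : ι} {A : X i → X i → ℝ} (hA : IsStochastic A) (t : ℝ) :
    heatKernel (coordKernel i A) t = coordKernel i (heatKernel A t) := by
  ext x y
  rw [coordKernel_eq_mul_prod_erase, heatKernel, heatKernel, mul_assoc, ← tsum_mul_right]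
  simp_rw [kernelPow_coordKernel hA, coordKernel_eq_mul_prod_erase, mul_assoc]

theorem commute_kernelOp_coordKernel {K : ∀ i, X i → X i → ℝ} (hK : ∀ i, IsStochastic (K i))
    (i j : ι) : Commute (kernelOp (coordKernel i (K i)) (isStochastic_coordKernel (hK i)))
      (kernelOp (coordKernel j (K j)) (isStochastic_coordKernel (hK j))) := by
  obtain rfl | hij := eq_or_ne i j
  · exact Commute.refl _
  have hpush : ∀ {i j : ι}, j ≠ i → ∀ x, push (coordKernel i (K i) x) (coordKernel j (K j))
      = tensor (Function.update (Function.update (fun _ => idKernel) i (K i)) j (K j)) x := by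
    intro i j hji x
    rw [coordKernel, push_tensor_coordKernel (isStochastic_update_idKernel (hK i)) (hK j),
      Function.update_of_ne hji]
    simp only [push_of_idKernel]
  refine ext_entry fun x y => ?_
  simp only [entry_mul, entry_kernelOp]
  exact congrFun ((hpush hij x).trans
    ((congrArg (tensor · x) (Function.update_comm hij.symm _ _ _)).trans (hpush hij.symm x).symm)) y

/-! ### The heat kernel of a product chain -/

theorem entry_exp_sum_kernelOp {K : ∀ i, X i → X i → ℝ} (hK : ∀ i, IsStochastic (K i)) {τ : ι → ℝ}
    (hτ : ∀ i, 0 ≤ τ i) (S : Finset ι) (x y : ∀ i, X i) :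
    entry x y (NormedSpace.exp (∑ i ∈ S, τ i •
        (kernelOp (coordKernel i (K i)) (isStochastic_coordKernel (hK i)) - 1)))
      = tensor (S.piecewise (fun i => heatKernel (K i) (τ i)) fun _ => idKernel) x y := by
  induction S using Finset.induction_on generalizing y with
  | empty =>
    rw [Finset.sum_empty, NormedSpace.exp_zero, entry_one, idKernel_pi, Finset.piecewise_empty]
  | insert a S ha ih =>
    have hcomm : ∀ i ∈ S,
        Commute (τ a • (kernelOp (coordKernel a (K a)) (isStochastic_coordKernel (hK a)) - 1))
          (τ i • (kernelOp (coordKernel i (K i)) (isStochastic_coordKernel (hK i)) - 1)) :=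
      fun i _ => ((((commute_kernelOp_coordKernel hK a i).sub_left (Commute.one_left _)).sub_right
        (Commute.one_right _)).smul_left _).smul_right _
    have hstoch : ∀ i, IsStochastic
        (S.piecewise (fun i => heatKernel (K i) (τ i)) (fun _ => idKernel) i) := fun i =>
      S.piecewise_cases _ _ _ (isStochastic_heatKernel (hK i) (hτ i)) isStochastic_idKernel
    rw [Finset.sum_insert ha, exp_add_of_commute (Commute.sum_right _ _ _ hcomm), entry_mul]
    change push _ (fun z w => entry z w (heatOp _ _ (τ a))) y = _
    simp only [ih, entry_heatOp, heatKernel_coordKernel (hK a)]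
    rw [push_tensor_coordKernel hstoch (isStochastic_heatKernel (hK a) (hτ a)),
      Finset.piecewise_insert, Finset.piecewise_eq_of_notMem _ _ _ ha]
    simp only [push_of_idKernel]

theorem prodKernel_eq_sum (w : ι → ℝ) (K : ∀ i, X i → X i → ℝ) (x y : ∀ i, X i) :
    prodKernel w K x y = ∑ i, w i * coordKernel i (K i) x y := by
  refine Finset.sum_congr rfl fun i _ => congrArg _ (Finset.prod_congr rfl fun j _ => ?_)
  obtain rfl | hj := eq_or_ne j i
  · simp
  · simp [hj]

theorem isStochastic_prodKernel {w : ι → ℝ} (hw : ∀ i, 0 ≤ w i) (hw1 : ∑ i, w i = 1)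
    {K : ∀ i, X i → X i → ℝ} (hK : ∀ i, IsStochastic (K i)) :
    IsStochastic (prodKernel w K) := fun x => by
  have hcoord : ∀ i, IsProb (coordKernel i (K i) x) := fun i => isStochastic_coordKernel (hK i) x
  refine ⟨fun y => ?_, ?_⟩
  · rw [prodKernel_eq_sum]
    exact Finset.sum_nonneg fun i _ => mul_nonneg (hw i) ((hcoord i).nonneg y)
  · have h := hasSum_sum (s := Finset.univ) fun i _ => (hcoord i).hasSum.mul_left (w i)
    simp only [mul_one, hw1] at h
    exact h.congr_fun fun y => prodKernel_eq_sum w K x y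

theorem heatKernel_prodKernel {w : ι → ℝ} (hw : ∀ i, 0 ≤ w i) (hw1 : ∑ i, w i = 1)
    {K : ∀ i, X i → X i → ℝ} (hK : ∀ i, IsStochastic (K i)) {t : ℝ} (ht : 0 ≤ t) :
    heatKernel (prodKernel w K) t = tensor fun i => heatKernel (K i) (w i * t) := by
  have hgen : t • (kernelOp (prodKernel w K) (isStochastic_prodKernel hw hw1 hK) - 1)
      = ∑ i, (w i * t) •
        (kernelOp (coordKernel i (K i)) (isStochastic_coordKernel (hK i)) - 1) := by
    refine ext_entry fun x y => ?_
    simp only [map_sum, map_smul, map_sub, entry_kernelOp, entry_one, prodKernel_eq_sum,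
      smul_eq_mul, mul_sub, Finset.sum_sub_distrib, ← Finset.sum_mul, hw1, one_mul, Finset.mul_sum]
    exact congrArg (· - _) (Finset.sum_congr rfl fun i _ => by ring)
  ext x y
  rw [← entry_heatOp (isStochastic_prodKernel hw hw1 hK), heatOp, hgen,
    entry_exp_sum_kernelOp hK (fun i => mul_nonneg (hw i) ht), Finset.piecewise_univ]

end tensor

/-! ### The maximum distance of a continuous time chain -/

/-- `(X, K, π)` is a Markov chain, not necessarily irreducible: `K` is a stochastic matrix and `π`
is a stationary probability of `K`. -/
structure IsStationaryChain (K : X → X → ℝ) (π : X → ℝ) : Prop where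
  isStochastic : IsStochastic K
  isProb : IsProb π
  push_eq : push π K = π

theorem IsIrreducibleChain.isStationaryChain {π : X → ℝ} (h : IsIrreducibleChain K π) :
    IsStationaryChain K π where
  isStochastic x := ⟨h.nonneg x, h.hasSum_row x⟩
  isProb := ⟨h.pi_nonneg, h.hasSum_pi⟩
  push_eq := funext fun y => (h.stationary y).tsum_eq

section maxDist

variable {π : X → ℝ} (D : DistKind) {s t ε : ℝ}

theorem probDist_le_maxDist (hK : IsStochastic K) (hπ : IsProb π) (ht : 0 ≤ t) (x : X) :
    probDist D (heatKernel K t x) π ≤ maxDist D K π t :=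
  le_ciSup (f := fun x => probDist D (heatKernel K t x) π) ⟨1, Set.forall_mem_range.2 fun x =>
    probDist_le_one D (isStochastic_heatKernel hK ht x) hπ⟩ x

theorem maxDist_nonneg (hK : IsStochastic K) (hπ : IsProb π) (ht : 0 ≤ t) : 0 ≤ maxDist D K π t :=
  Real.iSup_nonneg fun x => probDist_nonneg D (isStochastic_heatKernel hK ht x) hπ

theorem maxDist_le_one (hK : IsStochastic K) (hπ : IsProb π) (ht : 0 ≤ t) : maxDist D K π t ≤ 1 :=
  Real.iSup_le (fun x => probDist_le_one D (isStochastic_heatKernel hK ht x) hπ) zero_le_one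

variable (hC : IsStationaryChain K π)
include hC

theorem antitoneOn_maxDist : AntitoneOn (maxDist D K π) (Set.Ici 0) := by
  intro s hs t _ hst
  refine Real.iSup_le (fun x => ?_) (maxDist_nonneg D hC.isStochastic hC.isProb hs)
  have hpush := probDist_push_le D (isStochastic_heatKernel hC.isStochastic hs x) hC.isProb
    (isStochastic_heatKernel hC.isStochastic (sub_nonneg.2 hst))
  rw [push_heatKernel_heatKernel hC.isStochastic,
    push_heatKernel hC.isStochastic hC.isProb hC.push_eq, add_sub_cancel] at hpush
  exact hpush.trans (probDist_le_maxDist D hC.isStochastic hC.isProb hs x)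

theorem maxDist_add_le (hs : 0 ≤ s) (ht : 0 ≤ t) :
    maxDist D K π (s + t) ≤ 2 * rho D * maxDist D K π s * maxDist D K π t := by
  have hρ := rho_pos D
  have hds := maxDist_nonneg D hC.isStochastic hC.isProb hs
  have hdt := maxDist_nonneg D hC.isStochastic hC.isProb ht
  have hπt := push_heatKernel hC.isStochastic hC.isProb hC.push_eq t
  refine Real.iSup_le (fun x => ?_) (by positivity)
  rw [← push_heatKernel_heatKernel hC.isStochastic, ← hπt]
  refine (probDist_push_le_mul D (isStochastic_heatKernel hC.isStochastic hs x) hC.isProb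
    (isStochastic_heatKernel hC.isStochastic ht) hdt fun z => ?_).trans ?_
  · rw [hπt]
    exact probDist_le_maxDist D hC.isStochastic hC.isProb ht z
  · rw [hπt]
    gcongr
    exact probDist_le_maxDist D hC.isStochastic hC.isProb hs x

theorem maxDist_nat_mul_le (ht : 0 ≤ t) (m : ℕ) :
    maxDist D K π (m * t) ≤ (2 * rho D * maxDist D K π t) ^ m := by
  have hρ := rho_pos D
  have hdt := maxDist_nonneg D hC.isStochastic hC.isProb ht
  induction m with
  | zero => simpa using maxDist_le_one D hC.isStochastic hC.isProb le_rfl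
  | succ m ih =>
    calc maxDist D K π ((m + 1 : ℕ) * t)
        = maxDist D K π (m * t + t) := by rw [Nat.cast_succ, add_one_mul]
      _ ≤ 2 * rho D * maxDist D K π (m * t) * maxDist D K π t :=
        maxDist_add_le D hC (by positivity) ht
      _ = maxDist D K π (m * t) * (2 * rho D * maxDist D K π t) := by ring
      _ ≤ (2 * rho D * maxDist D K π t) ^ (m + 1) := by
        rw [pow_succ]
        gcongr

theorem maxDist_le_of_mixingTime_lt (hfin : MixingTimeFinite D K π ε)
    (ht : mixingTime D K π ε < t) : maxDist D K π t ≤ ε := by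
  obtain ⟨s, ⟨hs0, hs⟩, hst⟩ := exists_lt_of_csInf_lt hfin ht
  exact (antitoneOn_maxDist D hC hs0 (hs0.trans hst.le) hst.le).trans hs

omit hC in
theorem lt_maxDist_of_lt_mixingTime (ht0 : 0 ≤ t) (ht : t < mixingTime D K π ε) :
    ε < maxDist D K π t := by
  by_contra! h
  exact ht.not_ge (csInf_le ⟨0, fun s hs => hs.1⟩ ⟨ht0, h⟩)

omit hC in
theorem IsProb.exists_le_half [Nontrivial X] (hπ : IsProb π) : ∃ x, π x ≤ 1 / 2 := by
  classical
  obtain ⟨x, y, hxy⟩ := exists_pair_ne X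
  have hsum := sum_le_hasSum {x, y} (fun z _ => hπ.nonneg z) hπ.hasSum
  rw [Finset.sum_pair hxy] at hsum
  by_contra! h
  linarith [h x, h y]

omit hC in
theorem half_sub_le_rho_mul_maxDist [Nontrivial X] (hK : IsStochastic K) (hπ : IsProb π)
    (ht : 0 ≤ t) : 1 / 2 - t ≤ rho D * maxDist D K π t := by
  have hρ := rho_pos D
  obtain ⟨x, hx⟩ := hπ.exists_le_half
  have hH := isStochastic_heatKernel hK ht x
  calc 1 / 2 - t ≤ Real.exp (-t) - π x := by linarith [Real.add_one_le_exp (-t)]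
    _ ≤ heatKernel K t x x - π x := sub_le_sub_right (exp_neg_le_heatKernel_self hK ht x) _
    _ ≤ tvDist (heatKernel K t x) π := sub_le_tvDist hH hπ x
    _ ≤ rho D * probDist D (heatKernel K t x) π := tvDist_le_rho_mul_probDist D hH hπ
    _ ≤ rho D * maxDist D K π t := by
      gcongr
      exact probDist_le_maxDist D hK hπ ht x

theorem mixingTime_pos [Nontrivial X] (hε : 2 * rho D * ε < 1) (hfin : MixingTimeFinite D K π ε) :
    0 < mixingTime D K π ε := by
  have ht : 0 < (1 / 2 - rho D * ε) / 2 := by linarith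
  refine ht.trans_le (le_of_not_gt fun hlt => ?_)
  have hle := maxDist_le_of_mixingTime_lt D hC hfin hlt
  have hge := half_sub_le_rho_mul_maxDist D hC.isStochastic hC.isProb ht.le
  linarith [mul_le_mul_of_nonneg_left hle (rho_pos D).le]

theorem maxDist_le_rpow_of_maxDist_le {u : ℝ} (hε0 : 0 < ε) (hε : 2 * rho D * ε < 1) (hu : 0 < u)
    (hd : maxDist D K π u ≤ ε) (ht : 0 ≤ t) :
    maxDist D K π t ≤ (2 * rho D * ε) ^ (t / u - 1) := by
  have hρ := rho_pos D
  have hfloor : (⌊t / u⌋₊ : ℝ) * u ≤ t := by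
    rw [← le_div_iff₀ hu]
    exact Nat.floor_le (by positivity)
  calc maxDist D K π t ≤ maxDist D K π (⌊t / u⌋₊ * u) :=
        antitoneOn_maxDist D hC (Set.mem_Ici.2 (by positivity)) ht hfloor
    _ ≤ (2 * rho D * maxDist D K π u) ^ ⌊t / u⌋₊ := maxDist_nat_mul_le D hC hu.le _
    _ ≤ (2 * rho D * ε) ^ ⌊t / u⌋₊ := by
      have := maxDist_nonneg D hC.isStochastic hC.isProb hu.le
      gcongr
    _ = (2 * rho D * ε) ^ (⌊t / u⌋₊ : ℝ) := (Real.rpow_natCast _ _).symm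
    _ ≤ (2 * rho D * ε) ^ (t / u - 1) :=
      Real.rpow_le_rpow_of_exponent_ge (by positivity) hε.le (Nat.sub_one_lt_floor _).le

theorem maxDist_le_rpow [Nontrivial X] (hε0 : 0 < ε) (hε : 2 * rho D * ε < 1)
    (hfin : MixingTimeFinite D K π ε) (ht : 0 ≤ t) :
    maxDist D K π t ≤ (2 * rho D * ε) ^ (t / mixingTime D K π ε - 1) := by
  have hρ := rho_pos D
  have hT := mixingTime_pos D hC hε hfin
  have hlim : Tendsto (fun u => (2 * rho D * ε) ^ (t / u - 1)) (𝓝[>] mixingTime D K π ε)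
      (𝓝 ((2 * rho D * ε) ^ (t / mixingTime D K π ε - 1))) :=
    (tendsto_const_nhds.rpow ((tendsto_const_nhds.div tendsto_id hT.ne').sub_const 1)
      (Or.inl (by positivity))).mono_left nhdsWithin_le_nhds
  exact ge_of_tendsto hlim <| eventually_mem_nhdsWithin.mono fun u hu =>
    maxDist_le_rpow_of_maxDist_le D hC hε0 hε (hT.trans hu)
      (maxDist_le_of_mixingTime_lt D hC hfin hu) ht

end maxDist

/-! ### The maximum distance of a product chain -/

section prodMaxDist

variable {ι : Type v} [Fintype ι] {X : ι → Type u} {μ ν : ∀ i, X i → ℝ} (D : DistKind)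

theorem prod_affinity_le (hμ : ∀ i, IsProb (μ i)) (hν : ∀ i, IsProb (ν i)) :
    ∏ i, affinity D (μ i) (ν i) ≤ affinity D (prodPi μ) (prodPi ν) := by
  have h := hasSum_pi_prod (f := fun i x => overlap D (μ i x) (ν i x))
    (fun i x => overlap_nonneg D ((hμ i).nonneg x) ((hν i).nonneg x))
    fun i => hasSum_overlap D (hμ i) (hν i)
  refine hasSum_le (fun x => ?_) h (hasSum_overlap D (isProb_prodPi hμ) (isProb_prodPi hν))
  exact prod_overlap_le D Finset.univ (fun i => (hμ i).nonneg (x i)) fun i => (hν i).nonneg (x i)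

theorem hasSum_prodPi_mul_eval (hμ : ∀ i, IsProb (μ i)) {i : ι} {g : X i → ℝ} (hg : ∀ x, 0 ≤ g x)
    {c : ℝ} (h : HasSum (fun x => μ i x * g x) c) :
    HasSum (fun x => prodPi μ x * g (x i)) c := by
  classical
  let G : ∀ j, X j → ℝ := Function.update (fun _ _ => 1) i g
  have hG : ∀ j x, 0 ≤ G j x :=
    (Function.forall_update_iff _ fun j (g : X j → ℝ) => ∀ x, 0 ≤ g x).2
      ⟨hg, fun _ _ _ => zero_le_one⟩
  have hsum : ∀ j, HasSum (fun x => μ j x * G j x) (Function.update (fun _ => (1 : ℝ)) i c j) := by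
    intro j
    obtain rfl | hj := eq_or_ne j i
    · simpa only [G, Function.update_self] using h
    · simpa only [G, Function.update_of_ne hj, mul_one] using (hμ j).hasSum
  have hprod := hasSum_pi_prod (fun j x => mul_nonneg ((hμ j).nonneg x) (hG j x)) hsum
  rw [Finset.prod_update_of_mem (Finset.mem_univ i), Finset.prod_const_one, mul_one] at hprod
  refine hprod.congr_fun fun x => ?_
  have hGx : ∏ j, G j (x j) = g (x i) := by
    rw [Fintype.prod_eq_single i fun j hj => by simp only [G, Function.update_of_ne hj]]
    simp only [G, Function.update_self]
  rw [Finset.prod_mul_distrib, hGx, prodPi]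

theorem push_prodPi_eval (hμ : ∀ i, IsProb (μ i)) (i : ι) :
    push (prodPi μ) (fun x => idKernel (x i)) = μ i := by
  ext y
  have hsum := ((hμ i).summable_mul isStochastic_idKernel y).hasSum
  refine (hasSum_prodPi_mul_eval hμ (fun x => (isStochastic_idKernel x).nonneg y)
    hsum).tsum_eq.trans ?_
  exact congrFun (push_idKernel (μ i)) y

variable [DecidableEq ι] {K : ∀ i, X i → X i → ℝ} {π : ∀ i, X i → ℝ} {w : ι → ℝ} {t : ℝ}
  (hw : ∀ i, 0 ≤ w i) (hw1 : ∑ i, w i = 1) (hK : ∀ i, IsStochastic (K i))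
  (hπ : ∀ i, IsProb (π i)) (ht : 0 ≤ t)
include hw hw1 hK hπ ht

theorem maxDist_le_maxDist_prodKernel [∀ i, Nonempty (X i)] (i : ι) :
    maxDist D (K i) (π i) (w i * t) ≤ maxDist D (prodKernel w K) (prodPi π) t := by
  have hP := isStochastic_prodKernel hw hw1 hK
  have hH : ∀ x : ∀ i, X i, ∀ i, IsProb (heatKernel (K i) (w i * t) (x i)) := fun x i =>
    isStochastic_heatKernel (hK i) (mul_nonneg (hw i) ht) (x i)
  refine Real.iSup_le (fun z => ?_) (maxDist_nonneg D hP (isProb_prodPi hπ) ht)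
  obtain ⟨x, rfl⟩ := Function.surjective_eval i z
  refine le_trans ?_ (probDist_le_maxDist D hP (isProb_prodPi hπ) ht x)
  have hpush := probDist_push_le D (isProb_prodPi (hH x)) (isProb_prodPi hπ)
    (P := fun x : ∀ i, X i => idKernel (x i)) fun x => isStochastic_idKernel (x i)
  rw [push_prodPi_eval (hH x), push_prodPi_eval hπ] at hpush
  rwa [heatKernel_prodKernel hw hw1 hK ht]

theorem maxDist_prodKernel_rpow_le :
    maxDist D (prodKernel w K) (prodPi π) t ^ rho D
      ≤ 1 - ∏ i, (1 - maxDist D (K i) (π i) (w i * t) ^ rho D) := by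
  have hρ := rho_pos D
  have hwt : ∀ i, 0 ≤ w i * t := fun i => mul_nonneg (hw i) ht
  have hH : ∀ x : ∀ i, X i, ∀ i, IsProb (heatKernel (K i) (w i * t) (x i)) := fun x i =>
    isStochastic_heatKernel (hK i) (hwt i) (x i)
  have hd0 : ∀ i, 0 ≤ maxDist D (K i) (π i) (w i * t) := fun i =>
    maxDist_nonneg D (hK i) (hπ i) (hwt i)
  have hd1 : ∀ i, 0 ≤ 1 - maxDist D (K i) (π i) (w i * t) ^ rho D := fun i =>
    sub_nonneg.2 (Real.rpow_le_one (hd0 i) (maxDist_le_one D (hK i) (hπ i) (hwt i)) hρ.le)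
  have hc : 0 ≤ 1 - ∏ i, (1 - maxDist D (K i) (π i) (w i * t) ^ rho D) :=
    sub_nonneg.2 (Finset.prod_le_one (fun i _ => hd1 i) fun i _ =>
      sub_le_self _ (Real.rpow_nonneg (hd0 i) _))
  rw [← Real.le_rpow_inv_iff_of_pos (maxDist_nonneg D (isStochastic_prodKernel hw hw1 hK)
    (isProb_prodPi hπ) ht) hc hρ]
  refine Real.iSup_le (fun x => ?_) (Real.rpow_nonneg hc _)
  rw [heatKernel_prodKernel hw hw1 hK ht, tensor, Real.le_rpow_inv_iff_of_pos
    (probDist_nonneg D (isProb_prodPi (hH x)) (isProb_prodPi hπ)) hc hρ,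
    probDist_rpow_rho D (isProb_prodPi (hH x)) (isProb_prodPi hπ)]
  refine sub_le_sub_left ((Finset.prod_le_prod (fun i _ => hd1 i) fun i _ => ?_).trans
    (prod_affinity_le D (hH x) hπ)) 1
  rw [sub_le_comm, ← probDist_rpow_rho D (hH x i) (hπ i)]
  exact Real.rpow_le_rpow (probDist_nonneg D (hH x i) (hπ i))
    (probDist_le_maxDist D (hK i) (hπ i) (hwt i) (x i)) hρ.le

end prodMaxDist

/-! ### Distances to equilibrium of a product and of its coordinates -/

/-- The properties of the maximum distance `d` of a continuous time chain, and of its mixing time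
`T` at level `ε`, that govern the cutoffs of products. -/
structure IsMixingCurve (D : DistKind) (ε T : ℝ) (d : ℝ → ℝ) : Prop where
  eps_pos : 0 < ε
  base_lt_one : 2 * rho D * ε < 1
  T_pos : 0 < T
  nonneg : ∀ {t}, 0 ≤ t → 0 ≤ d t
  le_one : ∀ {t}, 0 ≤ t → d t ≤ 1
  antitoneOn : AntitoneOn d (Set.Ici 0)
  le_eps : ∀ {t}, T < t → d t ≤ ε
  eps_lt : ∀ {t}, 0 ≤ t → t < T → ε < d t
  le_rpow : ∀ {t}, 0 ≤ t → d t ≤ (2 * rho D * ε) ^ (t / T - 1)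

theorem one_le_rho (D : DistKind) : 1 ≤ rho D := by
  cases D <;> norm_num [rho]

namespace IsMixingCurve

variable {D : DistKind} {ε T t : ℝ} {d : ℝ → ℝ}

theorem base_pos (h : IsMixingCurve D ε T d) : 0 < 2 * rho D * ε :=
  mul_pos (mul_pos two_pos (rho_pos D)) h.eps_pos

theorem eps_lt_half (h : IsMixingCurve D ε T d) : ε < 1 / 2 := by
  nlinarith [h.base_lt_one, one_le_rho D, h.eps_pos]

theorem rpow_rho_nonneg (h : IsMixingCurve D ε T d) (ht : 0 ≤ t) : 0 ≤ d t ^ rho D :=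
  Real.rpow_nonneg (h.nonneg ht) _

theorem rpow_rho_le_one (h : IsMixingCurve D ε T d) (ht : 0 ≤ t) : d t ^ rho D ≤ 1 :=
  Real.rpow_le_one (h.nonneg ht) (h.le_one ht) (rho_pos D).le

theorem rpow_rho_le_self (h : IsMixingCurve D ε T d) (ht : 0 ≤ t) : d t ^ rho D ≤ d t :=
  Real.rpow_le_self_of_le_one (h.nonneg ht) (h.le_one ht) (one_le_rho D)

theorem rpow_rho_le_mul (h : IsMixingCurve D ε T d) {α : ℝ} (hα : 0 < α) (hαε : α ≤ ε)
    (ht : 0 ≤ t) :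
    d t ^ rho D ≤ (2 * rho D * α) ^ (-rho D) * (2 * rho D * ε) ^ (rho D * (t / T)) := by
  have hρ := rho_pos D
  have hb := h.base_pos
  calc d t ^ rho D ≤ ((2 * rho D * ε) ^ (t / T - 1)) ^ rho D :=
        Real.rpow_le_rpow (h.nonneg ht) (h.le_rpow ht) hρ.le
    _ = (2 * rho D * ε) ^ (-rho D) * (2 * rho D * ε) ^ (rho D * (t / T)) := by
        rw [← Real.rpow_mul hb.le, ← Real.rpow_add hb]
        congr 1
        ring
    _ ≤ (2 * rho D * α) ^ (-rho D) * (2 * rho D * ε) ^ (rho D * (t / T)) := by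
        gcongr ?_ * _
        exact Real.rpow_le_rpow_of_nonpos (by positivity) (by gcongr) (neg_nonpos.2 hρ.le)

end IsMixingCurve

section maxRatio

variable {N : ℕ} {a p : Fin N → ℝ}

theorem div_le_maxRatio (a p : Fin N → ℝ) (i : Fin N) : a i / p i ≤ maxRatio a p :=
  le_ciSup (f := fun i => a i / p i) (Set.finite_range _).bddAbove i

theorem le_mul_maxRatio (hp : ∀ i, 0 < p i) (i : Fin N) : a i ≤ p i * maxRatio a p :=
  (div_le_iff₀' (hp i)).1 (div_le_maxRatio a p i)

theorem exists_mul_maxRatio_eq (hN : 0 < N) (hp : ∀ i, 0 < p i) :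
    ∃ i, p i * maxRatio a p = a i := by
  have : Nonempty (Fin N) := ⟨⟨0, hN⟩⟩
  obtain ⟨i, hi⟩ := exists_eq_ciSup_of_finite (f := fun i => a i / p i)
  exact ⟨i, by rw [maxRatio, ← hi, mul_div_cancel₀ _ (hp i).ne']⟩

theorem maxRatio_pos (hN : 0 < N) (ha : ∀ i, 0 < a i) (hp : ∀ i, 0 < p i) : 0 < maxRatio a p :=
  (div_pos (ha ⟨0, hN⟩) (hp _)).trans_le (div_le_maxRatio a p ⟨0, hN⟩)

end maxRatio

theorem one_sub_sum_le_prod_one_sub {ι : Type v} (S : Finset ι) {x : ι → ℝ} (h0 : ∀ i, 0 ≤ x i)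
    (h1 : ∀ i, x i ≤ 1) : 1 - ∑ i ∈ S, x i ≤ ∏ i ∈ S, (1 - x i) := by
  classical
  induction S using Finset.induction_on with
  | empty => simp
  | insert a S ha ih =>
    rw [Finset.sum_insert ha, Finset.prod_insert ha]
    have hmul := mul_le_mul_of_nonneg_left ih (sub_nonneg.2 (h1 a))
    have hcross : 0 ≤ x a * ∑ i ∈ S, x i := mul_nonneg (h0 a) (Finset.sum_nonneg fun i _ => h0 i)
    nlinarith

theorem card_last_le (N m : ℕ) :
    (Finset.univ.filter fun i : Fin N => ¬ i.val + m < N).card ≤ m := by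
  have hinj : Set.InjOn (fun i : Fin N => N - 1 - i.val) {i | ¬ i.val + m < N} := by
    intro i _ j _ hij
    simp only at hij
    exact Fin.ext (by omega)
  calc (Finset.univ.filter fun i : Fin N => ¬ i.val + m < N).card
      ≤ (Finset.range m).card := Finset.card_le_card_of_injOn (fun i => N - 1 - i.val)
        (fun i hi => by
          simp only [Finset.coe_filter, Finset.mem_univ, true_and, Set.mem_ofPred_eq,
            Finset.coe_range, Set.mem_Iio] at hi ⊢
          omega) (by simpa using hinj)
    _ = m := Finset.card_range m

/-- The relations between the maximum distances `d i` of the coordinate chains, with mixing times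
`T i` at levels `ε i`, and the maximum distance `P` of the product chain with weights `p`. Time is
scaled so that at time `t` the `i`-th coordinate has run for time `p i * t`. -/
structure IsProductCurve (D : DistKind) {N : ℕ} (p ε T : Fin N → ℝ) (d : Fin N → ℝ → ℝ)
    (P : ℝ → ℝ) : Prop where
  coord : ∀ i, IsMixingCurve D (ε i) (T i) (d i)
  p_pos : ∀ i, 0 < p i
  nonneg : ∀ {t}, 0 ≤ t → 0 ≤ P t
  le_one : ∀ {t}, 0 ≤ t → P t ≤ 1
  coord_le : ∀ i {t}, 0 ≤ t → d i (p i * t) ≤ P t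
  rpow_rho_le : ∀ {t}, 0 ≤ t → P t ^ rho D ≤ 1 - ∏ i, (1 - d i (p i * t) ^ rho D)

namespace IsProductCurve

variable {D : DistKind} {N : ℕ} {p ε T : Fin N → ℝ} {d : Fin N → ℝ → ℝ} {P : ℝ → ℝ} {α c t η : ℝ}
  {m : ℕ} (h : IsProductCurve D p ε T d P)
include h

theorem p_mul_nonneg (i : Fin N) (ht : 0 ≤ t) : 0 ≤ p i * t :=
  mul_nonneg (h.p_pos i).le ht

theorem maxRatio_pos (hN : 0 < N) : 0 < maxRatio T p :=
  ProductChain.maxRatio_pos hN (fun i => (h.coord i).T_pos) h.p_pos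

theorem sum_tail_le (hα : 0 < α) (hαε : ∀ i, α ≤ ε i) (ht : 0 ≤ t) (hct : c * maxRatio T p ≤ t)
    (m : ℕ) :
    ∑ i with i.val + m < N, d i (p i * t) ^ rho D
      ≤ (2 * rho D * α) ^ (-rho D) * tailSum D ε p T c m := by
  have hρ := rho_pos D
  rw [tailSum, Finset.mul_sum]
  refine Finset.sum_le_sum fun i _ => ((h.coord i).rpow_rho_le_mul hα (hαε i)
    (h.p_mul_nonneg i ht)).trans ?_
  have hp := h.p_pos i
  have hT := (h.coord i).T_pos
  gcongr _ * ?_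
  refine Real.rpow_le_rpow_of_exponent_ge (h.coord i).base_pos (h.coord i).base_lt_one.le ?_
  calc c * rho D * maxRatio T p * p i / T i = rho D * (p i * (c * maxRatio T p) / T i) := by ring
    _ ≤ rho D * (p i * t / T i) := by gcongr

theorem le_add_of_tailSum_lt (hα : 0 < α) (hαε : ∀ i, α ≤ ε i) {C : ℝ} (hc : 0 ≤ c) (hC : 0 ≤ C)
    (hm : tailSum D ε p T c m < (2 * rho D * α) ^ (c * rho D * C)) {i : Fin N}
    (hi : p i * maxRatio T p ≤ C * T i) : N ≤ i.val + m := by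
  by_contra! hlt
  have hρ := rho_pos D
  have hb := (h.coord i).base_pos
  have hT := (h.coord i).T_pos
  refine hm.not_ge ?_
  calc (2 * rho D * α) ^ (c * rho D * C) ≤ (2 * rho D * ε i) ^ (c * rho D * C) := by
        gcongr
        exact hαε i
    _ ≤ (2 * rho D * ε i) ^ (c * rho D * maxRatio T p * p i / T i) := by
        refine Real.rpow_le_rpow_of_exponent_ge hb (h.coord i).base_lt_one.le ?_
        calc c * rho D * maxRatio T p * p i / T i
            = c * rho D * (p i * maxRatio T p / T i) := by ring
          _ ≤ c * rho D * C := by gcongr; exact (div_le_iff₀ hT).2 hi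
    _ ≤ tailSum D ε p T c m :=
        Finset.single_le_sum
          (f := fun i => (2 * rho D * ε i) ^ (c * rho D * maxRatio T p * p i / T i))
          (fun j _ => Real.rpow_nonneg (h.coord j).base_pos.le _)
          (Finset.mem_filter.2 ⟨Finset.mem_univ i, hlt⟩)

theorem rpow_rho_le_add (hα : 0 < α) (hαε : ∀ i, α ≤ ε i) (ht : 0 ≤ t)
    (hct : c * maxRatio T p ≤ t) (hη : 0 ≤ η)
    (hlast : ∀ i : Fin N, N ≤ i.val + m → d i (p i * t) ≤ η) :
    P t ^ rho D ≤ (2 * rho D * α) ^ (-rho D) * tailSum D ε p T c m + m * η := by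
  have hprod := one_sub_sum_le_prod_one_sub Finset.univ
    (fun i => (h.coord i).rpow_rho_nonneg (h.p_mul_nonneg i ht))
    fun i => (h.coord i).rpow_rho_le_one (h.p_mul_nonneg i ht)
  have hsplit := Finset.sum_filter_add_sum_filter_not Finset.univ (fun i : Fin N => i.val + m < N)
    fun i => d i (p i * t) ^ rho D
  have hlast_sum : ∑ i with ¬ i.val + m < N, d i (p i * t) ^ rho D ≤ m * η := by
    refine (Finset.sum_le_card_nsmul _ _ η fun i hi => ?_).trans ?_
    · exact ((h.coord i).rpow_rho_le_self (h.p_mul_nonneg i ht)).trans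
        (hlast i (not_lt.1 (Finset.mem_filter.1 hi).2))
    · rw [nsmul_eq_mul]
      gcongr
      exact card_last_le N m
  linarith [h.rpow_rho_le ht, h.sum_tail_le hα hαε ht hct m]

theorem rpow_rho_le_one_sub (hα : 0 < α) (hαε : ∀ i, α ≤ ε i) (ht : 0 ≤ t)
    (hct : c * maxRatio T p ≤ t) (htail : (2 * rho D * α) ^ (-rho D) * tailSum D ε p T c m ≤ 1 / 2)
    (hη : 0 ≤ η) (hη1 : η ≤ 1) (hlast : ∀ i : Fin N, N ≤ i.val + m → d i (p i * t) ≤ 1 - η) :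
    P t ^ rho D ≤ 1 - η ^ m / 2 := by
  have hle_one := fun i => (h.coord i).rpow_rho_le_one (h.p_mul_nonneg i ht)
  have htail_prod : 1 / 2 ≤ ∏ i with i.val + m < N, (1 - d i (p i * t) ^ rho D) := by
    refine le_trans ?_ (one_sub_sum_le_prod_one_sub _
      (fun i => (h.coord i).rpow_rho_nonneg (h.p_mul_nonneg i ht)) hle_one)
    linarith [h.sum_tail_le hα hαε ht hct m]
  have hlast_prod : η ^ m ≤ ∏ i with ¬ i.val + m < N, (1 - d i (p i * t) ^ rho D) := by
    calc η ^ m ≤ η ^ (Finset.univ.filter fun i : Fin N => ¬ i.val + m < N).card :=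
          pow_le_pow_of_le_one hη hη1 (card_last_le N m)
      _ = ∏ i : Fin N with ¬ i.val + m < N, η := (Finset.prod_const _).symm
      _ ≤ ∏ i with ¬ i.val + m < N, (1 - d i (p i * t) ^ rho D) :=
        Finset.prod_le_prod (fun _ _ => hη) fun i hi => by
          linarith [(h.coord i).rpow_rho_le_self (h.p_mul_nonneg i ht),
            hlast i (not_lt.1 (Finset.mem_filter.1 hi).2)]
  have hprod : 1 / 2 * η ^ m ≤ ∏ i, (1 - d i (p i * t) ^ rho D) := by
    rw [← Finset.prod_filter_mul_prod_filter_not Finset.univ fun i : Fin N => i.val + m < N]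
    exact mul_le_mul htail_prod hlast_prod (by positivity)
      (Finset.prod_nonneg fun i _ => sub_nonneg.2 (hle_one i))
  linarith [h.rpow_rho_le ht]

end IsProductCurve

/-! ### Cutoffs -/

theorem limsup_div_le_one {s t : ℕ → ℝ} (ht : ∀ n, 0 < t n)
    (h : ∀ a : ℝ, 1 < a → ∀ᶠ n in atTop, s n ≤ a * t n) :
    limsup (fun n => ((s n / t n : ℝ) : EReal)) atTop ≤ 1 := by
  refine EReal.le_of_forall_lt_iff_le.1 fun a ha => ?_
  have ha' : 1 < a := by exact_mod_cast ha
  refine limsup_le_of_le (by isBoundedDefault) ((h a ha').mono fun n hn => ?_)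
  exact EReal.coe_le_coe_iff.2 ((div_le_iff₀ (ht n)).2 hn)

theorem tendsto_div_one {s t : ℕ → ℝ} (hs : ∀ n, 0 < s n) (ht : ∀ n, 0 < t n)
    (hst : ∀ a : ℝ, 1 < a → ∀ᶠ n in atTop, s n ≤ a * t n)
    (hts : ∀ a : ℝ, 1 < a → ∀ᶠ n in atTop, t n ≤ a * s n) :
    Tendsto (fun n => s n / t n) atTop (𝓝 1) := by
  refine tendsto_order.2 ⟨fun b hb => ?_, fun b hb => ?_⟩
  · rcases le_or_gt b 0 with hb0 | hb0
    · exact Eventually.of_forall fun n => hb0.trans_lt (div_pos (hs n) (ht n))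
    obtain ⟨a, ha1, hab⟩ := exists_between ((one_lt_div hb0).2 hb)
    rw [lt_div_iff₀' hb0] at hab
    filter_upwards [hts a ha1] with n hn
    rw [lt_div_iff₀ (ht n)]
    calc b * t n ≤ b * (a * s n) := by gcongr
      _ = b * a * s n := by ring
      _ < s n := mul_lt_of_lt_one_left (hs n) hab
  · obtain ⟨a, ha1, hab⟩ := exists_between hb
    exact (hst a ha1).mono fun n hn => ((div_le_iff₀ (ht n)).2 hn).trans_lt hab

theorem hasCutoffAt_comp_mul_iff {d : ℕ → ℝ → ℝ} {q t : ℕ → ℝ} (hq : ∀ n, 0 < q n) :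
    HasCutoffAt (fun n s => d n (q n * s)) t ↔ HasCutoffAt d fun n => q n * t n := by
  simp only [HasCutoffAt, mul_left_comm (q _), mul_pos_iff_of_pos_left (hq _)]

theorem tendsto_one_of_lt_apply_mul {d : ℕ → ℝ → ℝ} {a u : ℕ → ℝ}
    (hanti : ∀ n, AntitoneOn (d n) (Set.Ici 0)) (hle : ∀ n t, 0 ≤ t → d n t ≤ 1)
    (hu : ∀ n, 0 ≤ u n) (ha : Tendsto a atTop (𝓝 1)) (had : ∀ n, a n < d n (a n * u n)) {b : ℝ}
    (hb0 : 0 ≤ b) (hb1 : b < 1) : Tendsto (fun n => d n (b * u n)) atTop (𝓝 1) := by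
  refine tendsto_of_tendsto_of_tendsto_of_le_of_le' ha tendsto_const_nhds ?_
    (Eventually.of_forall fun n => hle n _ (mul_nonneg hb0 (hu n)))
  filter_upwards [ha.eventually_const_lt hb1] with n hn
  exact (had n).le.trans (hanti n (mul_nonneg hb0 (hu n)) (mul_nonneg (hb0.trans hn.le) (hu n))
    (mul_le_mul_of_nonneg_right hn.le (hu n)))

theorem eventually_last {k : ℕ → ℕ} (hk : ∀ n, 0 < k n) {Q : ∀ n, Fin (k n) → Prop}
    (h : ∀ l, ∀ᶠ n in atTop, Q n (fromEnd (hk n) l)) (m : ℕ) :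
    ∀ᶠ n in atTop, ∀ i : Fin (k n), k n ≤ i.val + m → Q n i := by
  have hall : ∀ᶠ n in atTop, ∀ l ∈ Finset.range m, Q n (fromEnd (hk n) l) :=
    (Finset.eventually_all _).2 fun l _ => h l
  filter_upwards [hall] with n hn i hi
  have hi_eq : fromEnd (hk n) (k n - 1 - i.val) = i := Fin.ext (by simp only [fromEnd]; omega)
  exact hi_eq ▸ hn (k n - 1 - i.val) (Finset.mem_range.2 (by omega))

theorem TailVanishes.exists_eventually_lt {D : DistKind} {k : ℕ → ℕ} {ε p T : ∀ n, Fin (k n) → ℝ}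
    {c : ℝ} (h : TailVanishes D ε p T c) {δ : ℝ} (hδ : 0 < δ) :
    ∃ m, ∀ᶠ n in atTop, tailSum D (ε n) (p n) (T n) c m < δ := by
  obtain ⟨m, hm⟩ := (h.eventually_lt_const (ENNReal.ofReal_pos.2 hδ)).exists
  exact ⟨m, (eventually_lt_of_limsup_lt hm).mono fun n hn => (ENNReal.ofReal_lt_ofReal_iff hδ).1 hn⟩

section LastCoordinates

variable {k : ℕ → ℕ} {hk : ∀ n, 0 < k n} {d : ∀ n, Fin (k n) → ℝ → ℝ} {τ : ∀ n, Fin (k n) → ℝ}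
  (hcut : ∀ m : ℕ, HasCutoffAt (fun n => d n (fromEnd (hk n) m)) fun n => τ n (fromEnd (hk n) m))
  {a b : ℝ}
include hcut

theorem eventually_last_lt (ha : 1 < a) (hb : 0 < b) (m : ℕ) :
    ∀ᶠ n in atTop, ∀ i : Fin (k n), k n ≤ i.val + m → d n i (a * τ n i) < b :=
  eventually_last hk (fun l => ((hcut l).2.1 a ha).eventually_lt_const hb) m

theorem eventually_last_gt (ha0 : 0 < a) (ha1 : a < 1) (hb : b < 1) (m : ℕ) :
    ∀ᶠ n in atTop, ∀ i : Fin (k n), k n ≤ i.val + m → b < d n i (a * τ n i) :=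
  eventually_last hk (fun l => ((hcut l).2.2 a ha0 ha1).eventually_const_lt hb) m

variable {D : DistKind} {ε T : ∀ n, Fin (k n) → ℝ}
  (hd : ∀ n i, IsMixingCurve D (ε n i) (T n i) (d n i))
include hd

theorem eventually_last_mul_le_mixingTime (ha0 : 0 < a) (ha1 : a < 1) (m : ℕ) :
    ∀ᶠ n in atTop, ∀ i : Fin (k n), k n ≤ i.val + m → a * τ n i ≤ T n i := by
  filter_upwards [eventually_last_gt hcut ha0 ha1 (b := 1 / 2) (by norm_num) m] with n hn i hi
  by_contra! hlt
  linarith [hn i hi, (hd n i).le_eps hlt, (hd n i).eps_lt_half]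

theorem eventually_last_mixingTime_le_mul {α : ℝ} (hα : 0 < α) (hαε : ∀ n i, α ≤ ε n i)
    (ha : 1 < a) (hτ : ∀ n i, 0 < τ n i) (m : ℕ) :
    ∀ᶠ n in atTop, ∀ i : Fin (k n), k n ≤ i.val + m → T n i ≤ a * τ n i := by
  filter_upwards [eventually_last_lt hcut ha hα m] with n hn i hi
  by_contra! hlt
  have haτ : 0 ≤ a * τ n i := mul_nonneg (zero_le_one.trans ha.le) (hτ n i).le
  linarith [hn i hi, (hd n i).eps_lt haτ hlt, hαε n i]

end LastCoordinates

section Families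

variable {D : DistKind} {k : ℕ → ℕ} {p ε T τ : ∀ n, Fin (k n) → ℝ}
  {d : ∀ n, Fin (k n) → ℝ → ℝ} {P : ℕ → ℝ → ℝ} {α a c : ℝ}
  (h : ∀ n, IsProductCurve D (p n) (ε n) (T n) (d n) (P n))
  (hα : 0 < α) (hαε : ∀ n i, α ≤ ε n i)
include h hα hαε

theorem exists_eventually_last {C : ℝ} (hc : 0 ≤ c) (hC : 0 ≤ C) (htail : TailVanishes D ε p T c) :
    ∃ m : ℕ, ∀ᶠ n in atTop, ∀ i : Fin (k n),
      p n i * maxRatio (T n) (p n) ≤ C * T n i → k n ≤ i.val + m := by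
  have hρ := rho_pos D
  obtain ⟨m, hm⟩ := htail.exists_eventually_lt
    (δ := (2 * rho D * α) ^ (c * rho D * C)) (by positivity)
  exact ⟨m, hm.mono fun n hn i hi => (h n).le_add_of_tailSum_lt hα (hαε n) hc hC hn hi⟩

theorem exists_eventually_maximizer (hk : ∀ n, 0 < k n) (hc : 0 ≤ c)
    (htail : TailVanishes D ε p T c) :
    ∃ m : ℕ, ∀ᶠ n in atTop, ∃ i : Fin (k n),
      p n i * maxRatio (T n) (p n) = T n i ∧ k n ≤ i.val + m := by
  obtain ⟨m, hm⟩ := exists_eventually_last h hα hαε hc zero_le_one htail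
  refine ⟨m, hm.mono fun n hn => ?_⟩
  obtain ⟨i, hi⟩ := exists_mul_maxRatio_eq (hk n) (h n).p_pos
  exact ⟨i, hi, hn i (by rw [hi, one_mul])⟩

theorem tendsto_prod_one {hk : ∀ n, 0 < k n} (hc : 0 ≤ c) (htail : TailVanishes D ε p T c)
    (hcut : ∀ m : ℕ, HasCutoffAt (fun n => d n (fromEnd (hk n) m)) fun n => τ n (fromEnd (hk n) m))
    (hτ : ∀ n i, 0 < τ n i) (ha0 : 0 < a) (ha1 : a < 1) :
    Tendsto (fun n => P n (a * maxRatio (T n) (p n))) atTop (𝓝 1) := by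
  have hs : ∀ n, 0 ≤ a * maxRatio (T n) (p n) := fun n =>
    (mul_pos ha0 ((h n).maxRatio_pos (hk n))).le
  refine tendsto_order.2 ⟨fun b hb => ?_, fun b hb =>
    Eventually.of_forall fun n => ((h n).le_one (hs n)).trans_lt hb⟩
  obtain ⟨r, har, hr1⟩ := exists_between ha1
  have hr0 := ha0.trans har
  obtain ⟨m, hm⟩ := exists_eventually_maximizer h hα hαε hk hc htail
  filter_upwards [hm, eventually_last_gt hcut hr0 hr1 hb m,
    eventually_last_mixingTime_le_mul hcut (fun n => (h n).coord) hα hαε ((one_lt_div ha0).2 har)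
      hτ m] with n ⟨i, hi, hlast⟩ hgt hT
  have hle : p n i * (a * maxRatio (T n) (p n)) ≤ r * τ n i :=
    calc p n i * (a * maxRatio (T n) (p n)) = a * T n i := by rw [← hi]; ring
      _ ≤ a * (r / a * τ n i) := by gcongr; exact hT i hlast
      _ = r * τ n i := by field_simp
  calc b < d n i (r * τ n i) := hgt i hlast
    _ ≤ d n i (p n i * (a * maxRatio (T n) (p n))) :=
      ((h n).coord i).antitoneOn ((h n).p_mul_nonneg i (hs n)) (mul_nonneg hr0.le (hτ n i).le) hle
    _ ≤ P n (a * maxRatio (T n) (p n)) := (h n).coord_le i (hs n)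

omit hα hαε in
theorem eventually_last_apply_mul_maxRatio_lt {hk : ∀ n, 0 < k n}
    (hcut : ∀ m : ℕ, HasCutoffAt (fun n => d n (fromEnd (hk n) m)) fun n => τ n (fromEnd (hk n) m))
    (hτ : ∀ n i, 0 < τ n i) (ha : 1 < a) {η : ℝ} (hη : 0 < η) (m : ℕ) :
    ∀ᶠ n in atTop, ∀ i : Fin (k n), k n ≤ i.val + m →
      d n i (p n i * (a * maxRatio (T n) (p n))) < η := by
  obtain ⟨r, hr1, hra⟩ := exists_between ha
  have hr0 : 0 < r := zero_lt_one.trans hr1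
  have ha0 : 0 < a := zero_lt_one.trans ha
  filter_upwards [eventually_last_lt hcut hr1 hη m, eventually_last_mul_le_mixingTime hcut
    (fun n => (h n).coord) (div_pos hr0 ha0) ((div_lt_one ha0).2 hra) m] with n hlt hT i hi
  have hs : 0 ≤ a * maxRatio (T n) (p n) := (mul_pos ha0 ((h n).maxRatio_pos (hk n))).le
  refine (((h n).coord i).antitoneOn (mul_nonneg hr0.le (hτ n i).le)
    ((h n).p_mul_nonneg i hs) ?_).trans_lt (hlt i hi)
  calc r * τ n i = a * (r / a * τ n i) := by field_simp
    _ ≤ a * (p n i * maxRatio (T n) (p n)) :=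
      mul_le_mul_of_nonneg_left ((hT i hi).trans (le_mul_maxRatio (h n).p_pos i)) ha0.le
    _ = p n i * (a * maxRatio (T n) (p n)) := by ring

theorem tendsto_prod_zero {hk : ∀ n, 0 < k n} (htail : TailVanishes D ε p T a)
    (hcut : ∀ m : ℕ, HasCutoffAt (fun n => d n (fromEnd (hk n) m)) fun n => τ n (fromEnd (hk n) m))
    (hτ : ∀ n i, 0 < τ n i) (ha : 1 < a) :
    Tendsto (fun n => P n (a * maxRatio (T n) (p n))) atTop (𝓝 0) := by
  have hρ := rho_pos D
  have hs : ∀ n, 0 ≤ a * maxRatio (T n) (p n) := fun n =>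
    (mul_pos (zero_lt_one.trans ha) ((h n).maxRatio_pos (hk n))).le
  refine tendsto_order.2 ⟨fun b hb => Eventually.of_forall fun n =>
    hb.trans_le ((h n).nonneg (hs n)), fun δ hδ => ?_⟩
  have hC : 0 < (2 * rho D * α) ^ (-rho D) := by positivity
  obtain ⟨m, hm⟩ := htail.exists_eventually_lt
    (δ := δ ^ rho D / 2 / (2 * rho D * α) ^ (-rho D)) (by positivity)
  have hη : 0 < δ ^ rho D / 2 / (m + 1) := by positivity
  filter_upwards [hm, eventually_last_apply_mul_maxRatio_lt h hcut hτ ha hη m] with n htail_lt hlast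
  rw [lt_div_iff₀' hC] at htail_lt
  have hlast_sum : m * (δ ^ rho D / 2 / (m + 1)) ≤ δ ^ rho D / 2 := by
    rw [mul_div_left_comm]
    exact mul_le_of_le_one_right (by positivity) ((div_le_one (by positivity)).2 (by linarith))
  have hP := (h n).rpow_rho_le_add hα (hαε n) (hs n) le_rfl hη.le fun i hi => (hlast i hi).le
  exact (Real.rpow_lt_rpow_iff ((h n).nonneg (hs n)) hδ.le hρ).1 (by linarith)

theorem hasCutoffAt_prod {hk : ∀ n, 0 < k n} (htail : ∀ c : ℝ, 1 < c → TailVanishes D ε p T c)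
    (hcut : ∀ m : ℕ, HasCutoffAt (fun n => d n (fromEnd (hk n) m)) fun n => τ n (fromEnd (hk n) m))
    (hτ : ∀ n i, 0 < τ n i) : HasCutoffAt P fun n => maxRatio (T n) (p n) :=
  ⟨fun n => (h n).maxRatio_pos (hk n),
    fun a ha => tendsto_prod_zero h hα hαε (htail a ha) hcut hτ ha,
    fun _ => tendsto_prod_one h hα hαε zero_le_two (htail 2 one_lt_two) hcut hτ⟩

theorem eventually_maxRatio_mixingTime_le {hk : ∀ n, 0 < k n} (hc : 0 ≤ c)
    (htail : TailVanishes D ε p T c)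
    (hcut : ∀ m : ℕ, HasCutoffAt (fun n => d n (fromEnd (hk n) m)) fun n => τ n (fromEnd (hk n) m))
    (hτ : ∀ n i, 0 < τ n i) (ha : 1 < a) :
    ∀ᶠ n in atTop, maxRatio (T n) (p n) ≤ a * maxRatio (τ n) (p n) := by
  obtain ⟨m, hm⟩ := exists_eventually_maximizer h hα hαε hk hc htail
  filter_upwards [hm, eventually_last_mixingTime_le_mul hcut (fun n => (h n).coord) hα hαε ha hτ m]
    with n ⟨i, hi, hlast⟩ hT
  have hp := (h n).p_pos i
  refine le_of_mul_le_mul_left ?_ hp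
  calc p n i * maxRatio (T n) (p n) = T n i := hi
    _ ≤ a * τ n i := hT i hlast
    _ ≤ a * (p n i * maxRatio (τ n) (p n)) := by
      gcongr
      exact le_mul_maxRatio (h n).p_pos i
    _ = p n i * (a * maxRatio (τ n) (p n)) := by ring

theorem eventually_maxRatio_le_maxRatio_mixingTime {hk : ∀ n, 0 < k n} (hc : 0 ≤ c)
    (htail : TailVanishes D ε p T c)
    (hcut : ∀ m : ℕ, HasCutoffAt (fun n => d n (fromEnd (hk n) m)) fun n => τ n (fromEnd (hk n) m))
    (hτ : ∀ n i, 0 < τ n i) {C : ℝ} (hC : ∀ n i, τ n i / T n i ≤ C) (ha : 1 < a) :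
    ∀ᶠ n in atTop, maxRatio (τ n) (p n) ≤ a * maxRatio (T n) (p n) := by
  have hT0 : ∀ n i, 0 < T n i := fun n i => ((h n).coord i).T_pos
  have hC0 : 0 ≤ C := (div_pos (hτ 0 ⟨0, hk 0⟩) (hT0 0 _)).le.trans (hC 0 _)
  have ha0 : 0 < a := zero_lt_one.trans ha
  obtain ⟨m, hm⟩ := exists_eventually_last h hα hαε hc hC0 htail
  filter_upwards [hm, eventually_last_mul_le_mixingTime hcut (fun n => (h n).coord)
    (inv_pos.2 ha0) (inv_lt_one_of_one_lt₀ ha) m] with n hn hT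
  obtain ⟨i, hi⟩ := exists_mul_maxRatio_eq (a := τ n) (hk n) (h n).p_pos
  have hp := (h n).p_pos i
  have hs := (h n).maxRatio_pos (hk n)
  rcases le_total (maxRatio (τ n) (p n)) (maxRatio (T n) (p n)) with hle | hle
  · exact hle.trans (le_mul_of_one_le_left hs.le ha.le)
  have hlast : k n ≤ i.val + m := hn i <|
    calc p n i * maxRatio (T n) (p n) ≤ p n i * maxRatio (τ n) (p n) := by gcongr
      _ = τ n i := hi
      _ ≤ C * T n i := (div_le_iff₀ (hT0 n i)).1 (hC n i)
  refine le_of_mul_le_mul_left ?_ hp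
  calc p n i * maxRatio (τ n) (p n) = τ n i := hi
    _ ≤ a * T n i := (inv_mul_le_iff₀ ha0).1 (hT i hlast)
    _ ≤ a * (p n i * maxRatio (T n) (p n)) := by
      gcongr
      exact le_mul_maxRatio (h n).p_pos i
    _ = p n i * (a * maxRatio (T n) (p n)) := by ring

theorem eventually_mul_maxRatio_le {u : ℕ → ℝ} (hk : ∀ n, 0 < k n) (hcut : HasCutoffAt P u)
    (hc : 0 < c) (hca : c < a) :
    ∀ᶠ n in atTop, c * maxRatio (T n) (p n) ≤ a * u n := by
  have ha0 := hc.trans hca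
  filter_upwards [(hcut.2.1 _ ((one_lt_div hc).2 hca)).eventually_lt_const hα] with n hn
  obtain ⟨i, hi⟩ := exists_mul_maxRatio_eq (a := T n) (hk n) (h n).p_pos
  have hu : 0 ≤ a / c * u n := (mul_pos (div_pos ha0 hc) (hcut.1 n)).le
  have hT : T n i ≤ p n i * (a / c * u n) := by
    by_contra! hlt
    linarith [((h n).coord i).eps_lt ((h n).p_mul_nonneg i hu) hlt, (h n).coord_le i hu, hαε n i]
  calc c * maxRatio (T n) (p n) ≤ c * (a / c * u n) := by
        gcongr
        exact le_of_mul_le_mul_left (hi.trans_le hT) ((h n).p_pos i)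
    _ = a * u n := by field_simp

theorem exists_eventually_exists_last_lt {u : ℕ → ℝ} (hk : ∀ n, 0 < k n) (hc0 : 0 < c)
    (htail : TailVanishes D ε p T c) (hcut : HasCutoffAt P u) :
    ∃ m : ℕ, ∀ a, c < a → a < 1 → ∀ᶠ n in atTop, ∃ i : Fin (k n),
      k n ≤ i.val + m ∧ a < d n i (p n i * (a * u n)) := by
  have hρ := rho_pos D
  have hC : 0 < (2 * rho D * α) ^ (-rho D) := by positivity
  obtain ⟨m, hm⟩ := htail.exists_eventually_lt (δ := 1 / 2 / (2 * rho D * α) ^ (-rho D))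
    (by positivity)
  refine ⟨m, fun a hca ha1 => ?_⟩
  have ha0 := hc0.trans hca
  have hlim : Tendsto (fun n => P n (a * u n) ^ rho D) atTop (𝓝 1) := by
    simpa only [Real.one_rpow] using (hcut.2.2 a ha0 ha1).rpow_const (Or.inr hρ.le)
  have hη : 0 < (1 - a) ^ m / 2 := half_pos (pow_pos (sub_pos.2 ha1) m)
  filter_upwards [hm, eventually_mul_maxRatio_le h hα hαε hk hcut hc0 hca,
    hlim.eventually_const_lt (sub_lt_self 1 hη)] with n htail_lt hs hP
  by_contra! hle
  rw [lt_div_iff₀' hC] at htail_lt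
  exact hP.not_ge ((h n).rpow_rho_le_one_sub hα (hαε n) (mul_pos ha0 (hcut.1 n)).le hs htail_lt.le
    (sub_nonneg.2 ha1.le) (sub_le_self 1 ha0.le) fun i hi => by rw [sub_sub_cancel]; exact hle i hi)

theorem exists_subfamily_hasCutoffAt {u : ℕ → ℝ} (hk : ∀ n, 0 < k n) (hc0 : 0 < c) (hc1 : c < 1)
    (htail : TailVanishes D ε p T c) (hcut : HasCutoffAt P u) :
    ∃ (j : ℕ → ℕ) (J : ∀ r, Fin (k (j r))), StrictMono j ∧
      (∃ M : ℕ, ∀ r, k (j r) ≤ (J r).val + M) ∧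
      HasCutoffAt (fun r => d (j r) (J r)) fun r => p (j r) (J r) * u (j r) := by
  obtain ⟨m, hm⟩ := exists_eventually_exists_last_lt h hα hαε hk hc0 htail hcut
  obtain ⟨a, -, ha, ha_lim⟩ := exists_seq_strictMono_tendsto' hc1
  obtain ⟨j, hj, hJ⟩ := extraction_forall_of_eventually fun r => hm (a r) (ha r).1 (ha r).2
  choose J hJm hJd using hJ
  have hu : ∀ r, 0 < u (j r) := fun r => hcut.1 (j r)
  refine ⟨j, J, hj, ⟨m, hJm⟩, fun r => mul_pos ((h _).p_pos _) (hu r), fun b hb => ?_,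
    fun b hb0 hb1 => ?_⟩
  · have hbu : ∀ r, 0 ≤ b * u (j r) := fun r => (mul_pos (zero_lt_one.trans hb) (hu r)).le
    simp only [mul_left_comm b]
    exact squeeze_zero (fun r => ((h _).coord _).nonneg ((h _).p_mul_nonneg _ (hbu r)))
      (fun r => (h _).coord_le _ (hbu r)) ((hcut.2.1 b hb).comp hj.tendsto_atTop)
  · refine tendsto_one_of_lt_apply_mul (fun r => ((h _).coord _).antitoneOn)
      (fun r t ht => ((h _).coord _).le_one ht) (fun r => (h _).p_mul_nonneg _ (hu r).le)
      ha_lim (fun r => ?_) hb0.le hb1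
    rw [mul_left_comm]
    exact hJd r

end Families

theorem IsStationaryChain.isMixingCurve {X : Type u} [Nontrivial X] {K : X → X → ℝ} {π : X → ℝ}
    (h : IsStationaryChain K π) {D : DistKind} {ε : ℝ} (hε0 : 0 < ε) (hε : ε < 1 / (2 * rho D))
    (hfin : MixingTimeFinite D K π ε) :
    IsMixingCurve D ε (mixingTime D K π ε) (maxDist D K π) := by
  have hbase : 2 * rho D * ε < 1 := by
    rwa [mul_comm, ← lt_div_iff₀ (mul_pos two_pos (rho_pos D))]
  exact
    { eps_pos := hε0
      base_lt_one := hbase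
      T_pos := mixingTime_pos D h hbase hfin
      nonneg := maxDist_nonneg D h.isStochastic h.isProb
      le_one := maxDist_le_one D h.isStochastic h.isProb
      antitoneOn := antitoneOn_maxDist D h
      le_eps := maxDist_le_of_mixingTime_lt D h hfin
      eps_lt := lt_maxDist_of_lt_mixingTime D
      le_rpow := maxDist_le_rpow D h hε0 hbase hfin }

theorem isProductCurve_prodMaxDist {D : DistKind} {N : ℕ} (hN : 0 < N) {X : Fin N → Type u}
    [∀ i, Nontrivial (X i)] {K : ∀ i, X i → X i → ℝ} {π : ∀ i, X i → ℝ}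
    (hchain : ∀ i, IsStationaryChain (K i) (π i)) {p : Fin N → ℝ} (hp : ∀ i, 0 < p i)
    {ε : Fin N → ℝ} (hε : ∀ i, 0 < ε i ∧ ε i < 1 / (2 * rho D))
    (hfin : ∀ i, MixingTimeFinite D (K i) (π i) (ε i)) :
    IsProductCurve D p ε (fun i => mixingTime D (K i) (π i) (ε i))
      (fun i => maxDist D (K i) (π i)) fun t => prodMaxDist D p K π ((∑ i, p i) * t) := by
  have hq : 0 < ∑ i, p i := Finset.sum_pos (fun i _ => hp i) ⟨⟨0, hN⟩, Finset.mem_univ _⟩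
  have hw : ∀ i, 0 ≤ p i / ∑ j, p j := fun i => (div_pos (hp i) hq).le
  have hw1 : ∑ i, p i / ∑ j, p j = 1 := by rw [← Finset.sum_div, div_self hq.ne']
  have hK := fun i => (hchain i).isStochastic
  have hπ := fun i => (hchain i).isProb
  have hP := isStochastic_prodKernel hw hw1 hK
  have htime : ∀ i t, p i / (∑ j, p j) * ((∑ j, p j) * t) = p i * t := fun i t => by field_simp
  refine
    { coord := fun i => (hchain i).isMixingCurve (hε i).1 (hε i).2 (hfin i)
      p_pos := hp
      nonneg := fun ht => maxDist_nonneg D hP (isProb_prodPi hπ) (mul_nonneg hq.le ht)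
      le_one := fun ht => maxDist_le_one D hP (isProb_prodPi hπ) (mul_nonneg hq.le ht)
      coord_le := fun i t ht => ?_
      rpow_rho_le := fun {t} ht => ?_ }
  · rw [← htime]
    exact maxDist_le_maxDist_prodKernel D hw hw1 hK hπ (mul_nonneg hq.le ht) i
  · simp only [← htime _ t]
    exact maxDist_prodKernel_rpow_le D hw hw1 hK hπ (mul_nonneg hq.le ht)

end

end ProductChain

theorem theorem4p3_general
    (D : ProductChain.DistKind)
    (k : ℕ → ℕ) (hk_pos : ∀ n, 0 < k n)
    (X : ∀ n, Fin (k n) → Type*) [∀ n i, Nontrivial (X n i)]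
    (K : ∀ n i, X n i → X n i → ℝ) (π : ∀ n i, X n i → ℝ)
    (hchain : ∀ n i, IsStationaryChain (K n i) (π n i))
    (p : ∀ n, Fin (k n) → ℝ) (hp : ∀ n i, 0 < p n i)
    (ε : ∀ n, Fin (k n) → ℝ)
    (hε : ∀ n i, 0 < ε n i ∧ ε n i < 1 / (2 * rho D))
    (hε_inf : ∃ α : ℝ, 0 < α ∧ ∀ n i, α ≤ ε n i)
    (T : ∀ n, Fin (k n) → ℝ)
    (hT_fin : ∀ n i, MixingTimeFinite D (K n i) (π n i) (ε n i))
    (hT : ∀ n i, T n i = mixingTime D (K n i) (π n i) (ε n i))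
    (s : ℕ → ℝ) (hs : ∀ n, s n = maxRatio (T n) (p n))
    (q : ℕ → ℝ) (hq : ∀ n, q n = ∑ i, p n i) :
    (∀ τ : ∀ n, Fin (k n) → ℝ, (∀ n i, 0 < τ n i) →
      (∀ c : ℝ, 1 < c → TailVanishes D ε p T c) →
      (∀ m : ℕ, HasCutoffAt
        (fun n => maxDist D (K n (fromEnd (hk_pos n) m)) (π n (fromEnd (hk_pos n) m)))
        (fun n => τ n (fromEnd (hk_pos n) m))) →
      HasCutoffAt (fun n => prodMaxDist D (p n) (K n) (π n)) (fun n => q n * s n) ∧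
      limsup (fun n => ((s n / maxRatio (τ n) (p n) : ℝ) : EReal)) atTop ≤ 1 ∧
      ((∃ C : ℝ, ∀ n i, τ n i / T n i ≤ C) →
        Tendsto (fun n => s n / maxRatio (τ n) (p n)) atTop (𝓝 1))) ∧
    (∀ v : ℕ → ℝ,
      (∃ c : ℝ, 0 < c ∧ c < 1 ∧ TailVanishes D ε p T c) →
      HasCutoffAt (fun n => prodMaxDist D (p n) (K n) (π n)) v →
      ∃ (j : ℕ → ℕ) (J : ∀ r, Fin (k (j r))),
        StrictMono j ∧
        (∃ M : ℕ, ∀ r, k (j r) ≤ (J r).val + M) ∧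
        HasCutoffAt (fun r => maxDist D (K (j r) (J r)) (π (j r) (J r)))
          (fun r => p (j r) (J r) * v (j r) / q (j r))) := by
  obtain ⟨α, hα, hαε⟩ := hε_inf
  obtain rfl : T = fun n i => mixingTime D (K n i) (π n i) (ε n i) := funext₂ hT
  obtain rfl := funext hs
  obtain rfl := funext hq
  have h := fun n => isProductCurve_prodMaxDist (hk_pos n) (hchain n) (hp n) (hε n) (hT_fin n)
  have hq0 : ∀ n, 0 < ∑ i, p n i := fun n =>
    Finset.sum_pos (fun i _ => hp n i) ⟨⟨0, hk_pos n⟩, Finset.mem_univ _⟩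
  refine ⟨fun τ hτ htail hcut => ?_, fun v ⟨c, hc0, hc1, htail⟩ hcut => ?_⟩
  · have hτ0 := fun n => maxRatio_pos (hk_pos n) (hτ n) (hp n)
    have hle := fun a => eventually_maxRatio_mixingTime_le (a := a) h hα hαε zero_le_two
      (htail 2 one_lt_two) hcut hτ
    refine ⟨(hasCutoffAt_comp_mul_iff hq0).1 (hasCutoffAt_prod h hα hαε htail hcut hτ),
      limsup_div_le_one hτ0 hle, fun ⟨C, hC⟩ => ?_⟩
    exact tendsto_div_one (fun n => (h n).maxRatio_pos (hk_pos n)) hτ0 hle fun a =>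
      eventually_maxRatio_le_maxRatio_mixingTime h hα hαε zero_le_two (htail 2 one_lt_two) hcut
        hτ hC
  · have hv : v = fun n => (∑ i, p n i) * (v n / ∑ i, p n i) :=
      funext fun n => (mul_div_cancel₀ _ (hq0 n).ne').symm
    rw [hv, ← hasCutoffAt_comp_mul_iff hq0] at hcut
    simpa only [mul_div_assoc] using
      exists_subfamily_hasCutoffAt h hα hαε hk_pos hc0 hc1 htail hcut

theorem theorem4p3
    (D : ProductChain.DistKind)
    (k : ℕ → ℕ) (hk_pos : ∀ n, 0 < k n) (hk : Tendsto k atTop atTop)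
    (X : ∀ n, Fin (k n) → Type*) [∀ n i, Countable (X n i)] [∀ n i, Nontrivial (X n i)]
    (K : ∀ n i, X n i → X n i → ℝ) (π : ∀ n i, X n i → ℝ)
    (hchain : ∀ n i, IsIrreducibleChain (K n i) (π n i))
    (p : ∀ n, Fin (k n) → ℝ) (hp : ∀ n i, 0 < p n i)
    (ε : ∀ n, Fin (k n) → ℝ)
    (hε : ∀ n i, 0 < ε n i ∧ ε n i < 1 / (2 * rho D))
    (hε_inf : ∃ α : ℝ, 0 < α ∧ ∀ n i, α ≤ ε n i)
    (T : ∀ n, Fin (k n) → ℝ)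
    (hT_fin : ∀ n i, MixingTimeFinite D (K n i) (π n i) (ε n i))
    (hT : ∀ n i, T n i = mixingTime D (K n i) (π n i) (ε n i))
    (s : ℕ → ℝ) (hs : ∀ n, s n = maxRatio (T n) (p n))
    (q : ℕ → ℝ) (hq : ∀ n, q n = ∑ i, p n i) :
    (∀ τ : ∀ n, Fin (k n) → ℝ, (∀ n i, 0 < τ n i) →
      (∀ c : ℝ, 1 < c → TailVanishes D ε p T c) →
      (∀ m : ℕ, HasCutoffAt
        (fun n => maxDist D (K n (fromEnd (hk_pos n) m)) (π n (fromEnd (hk_pos n) m)))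
        (fun n => τ n (fromEnd (hk_pos n) m))) →
      HasCutoffAt (fun n => prodMaxDist D (p n) (K n) (π n)) (fun n => q n * s n) ∧
      limsup (fun n => ((s n / maxRatio (τ n) (p n) : ℝ) : EReal)) atTop ≤ 1 ∧
      ((∃ C : ℝ, ∀ n i, τ n i / T n i ≤ C) →
        Tendsto (fun n => s n / maxRatio (τ n) (p n)) atTop (𝓝 1))) ∧
    (∀ v : ℕ → ℝ,
      (∃ c : ℝ, 0 < c ∧ c < 1 ∧ TailVanishes D ε p T c) →
      HasCutoffAt (fun n => prodMaxDist D (p n) (K n) (π n)) v →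
      ∃ (j : ℕ → ℕ) (J : ∀ r, Fin (k (j r))),
        StrictMono j ∧
        (∃ M : ℕ, ∀ r, k (j r) ≤ (J r).val + M) ∧
        HasCutoffAt (fun r => maxDist D (K (j r) (J r)) (π (j r) (J r)))
          (fun r => p (j r) (J r) * v (j r) / q (j r))) :=
  theorem4p3_general D k hk_pos X K π (fun n i => (hchain n i).isStationaryChain) p hp ε hε hε_inf T
    hT_fin hT s hs q hq
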